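/- Let $\alpha,\gamma\in[0,1]$ and $D\in\{3,4,\dots\}\cup\{\infty\}$, and put $\eta=-\frac{1-\alpha}{D-2}$ if $D<\infty$ and $\eta=1-\gamma$ if $D=\infty$. In the attachment and grafting (ag) model, a random rooted planar tree whose root has degree one grows as follows. Call an edge a leaf if it is adjacent to a vertex of degree one other than the root, and an inner edge otherwise. Start from the unique tree with two edges; in each step choose, with probabilities proportional to the stated weights, either a vertex of degree $k\ge 2$ with weight $\eta k+1-2\eta-\alpha$ and attach a new edge to it, in one of the $k$ possible positions chosen uniformly; or an inner edge with weight $\alpha$ and divide it into two edges by a new vertex; or a leaf with weight $1-\eta$ and divide it into two edges by a new vertex. Let $\nu_n$ be the law of the resulting tree with $n$ edges ($\nu_1$ is concentrated on the tree with a single edge), let $h(T)$ be the height of $T$, i.e. the maximal distance of a vertex from the root, and set $\nu_0(\{h(T)\le R\})=1$ by convention. For $R\ge 0$ define $$C_{n,R}=\frac{-\eta\,\Gamma(n-\eta)}{\Gamma(1-\eta)\,\Gamma(n+1)}\,\nu_n(\{h(T)\le R\}),\qquad H_R(\zeta)=\sum_{n=0}^\infty C_{n,R}\,\zeta^n,$$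 where the Gamma quotient is understood as $(-\eta)(1-\eta)\cdots(n-1-\eta)/n!$ (to which it is equal for $\eta\ne 0,1$). Then for every real $\zeta\in[-1,1]$ the series $H_R(\zeta)$ converges for all $R\ge0$, $H_0(\zeta)=1$, and for every $R\ge 1$ $$H_R(\zeta)=1+\alpha\,H_{R-1}(\zeta)\int_0^\zeta H_{R-1}(y)^{\frac{\alpha-1}{\eta}}\,dy-(\alpha+\eta)\int_0^\zeta H_{R-1}(y)^{\frac{\alpha+\eta-1}{\eta}}\,dy .$$ Both integrands are integrable over the interval between $0$ and $\zeta$, except possibly the first one when $\alpha=0$ and $\zeta=1$, in which case the term with the factor $\alpha$ is read as $0$. If $\eta=0$, then $H_{R-1}\equiv 1$ and the powers are read as $1$. -/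

import Mathlib

namespace AgModel

/-- Finite planar trees whose root has valency one. `node [T₁, …, T_{k-1}]` is the tree in which the
unique neighbour of the root has degree `k` and carries, in the planar order, the subtrees
`T₁, …, T_{k-1}` (each of them again planted, its root being that neighbour). In particular
`node []` is the tree with a single edge. Every `node` inside the term stands for one
non-root vertex, and equally for the edge that joins this vertex to its parent. -/
inductive PlantedTree : Type
  | node : List PlantedTree → PlantedTree

open PlantedTree

mutual
/-- The height: the maximal distance from the root to a vertex. -/
def height : PlantedTree → ℕ
  | node cs => heightList cs + 1
/-- The maximum of the heights of the trees in a list (`0` for the empty list). -/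
def heightList : List PlantedTree → ℕ
  | [] => 0
  | T :: Ts => max (height T) (heightList Ts)
end

noncomputable section

/-- The parameter `η`, for a bound `D` on the vertex degrees (`D = ⊤` means no bound). -/
def eta (α γ : ℝ) (D : ℕ∞) : ℝ :=
  if D = ⊤ then 1 - γ else -((1 - α) / ((D.toNat : ℝ) - 2))

/-- The relative probability of grafting a vertex to the edge above a vertex with children `cs`:
the edge is a leaf if there are no children, and an inner edge otherwise. -/
def graftWeight (α η : ℝ) (cs : List PlantedTree) : ℝ :=
  if cs = [] then 1 - η else α

/-- The relative probability of selecting, for attachment, a vertex of degree `k`. -/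
def attachWeight (α η : ℝ) (k : ℕ) : ℝ :=
  η * k + 1 - 2 * η - α

/-- The ways of attaching a new edge to the vertex with children `cs`, with their relative
probabilities. If there are children, its degree is `k = cs.length + 1 ≥ 2`, and the weight is
shared equally between the `k` possible positions. -/
def attachMoves (α η : ℝ) (cs : List PlantedTree) : List (PlantedTree × ℝ) :=
  if cs = [] then []
  else (List.range (cs.length + 1)).map fun i =>
    (node (cs.insertIdx i (node [])),
      attachWeight α η (cs.length + 1) / ((cs.length + 1 : ℕ) : ℝ))

mutual
/-- All elementary growth moves from a tree: the resulting trees with the relative probabilities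
of the moves (different moves may lead to the same tree). The moves are the grafting of a vertex to
the root edge, the attachments to the neighbour of the root, and the moves inside a subtree. -/
def moves (α η : ℝ) : PlantedTree → List (PlantedTree × ℝ)
  | node cs =>
    (node [node cs], graftWeight α η cs) ::
      (attachMoves α η cs ++ (movesList α η cs).map fun m => (node m.1, m.2))
/-- All elementary growth moves that change exactly one tree of a list. -/
def movesList (α η : ℝ) : List PlantedTree → List (List PlantedTree × ℝ)
  | [] => []
  | T :: Ts =>
    (moves α η T).map (fun m => (m.1 :: Ts, m.2)) ++
      (movesList α η Ts).map (fun m => (T :: m.1, m.2))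
end

/-- The transition probabilities `ℙ(T → ·)`: the relative probabilities of the moves, normalised by
their sum. -/
def transition (α η : ℝ) (T : PlantedTree) : PlantedTree →₀ ℝ :=
  (((moves α η T).map Prod.snd).sum)⁻¹ •
    ((moves α η T).map fun m => Finsupp.single m.1 m.2).sum

/-- The law `ν_n` of the tree with `n` edges, as the finitely supported function
`T ↦ ν_n(T)`. The growth starts from the unique tree with two edges; `ν_1` is concentrated on the
only tree with one edge, and the value at `n = 0` is not used. -/
def nu (α η : ℝ) : ℕ → PlantedTree →₀ ℝ
  | 0 => 0
  | 1 => Finsupp.single (node []) 1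
  | 2 => Finsupp.single (node [node []]) 1
  | n + 3 => (nu α η (n + 2)).sum fun T p => p • transition α η T

/-- `ν_n({h(T) ≤ R})`, with the convention `ν_0({h(T) ≤ R}) = 1`. -/
def nuHeightLE (α η : ℝ) (n R : ℕ) : ℝ :=
  if n = 0 then 1 else (nu α η n).sum fun T p => if height T ≤ R then p else 0

/-- The number `-η Γ(n - η) / (Γ(1 - η) Γ(n + 1))`, written as
`(-η) (1 - η) ⋯ (n - 1 - η) / n!`. The product form also gives the value by continuity at `η = 0`
and `η = 1`, where the Gamma functions have poles; see `gammaCoeff_eq` for the other values. -/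
def gammaCoeff (η : ℝ) (n : ℕ) : ℝ :=
  (ascPochhammer ℝ n).eval (-η) / (n.factorial : ℝ)

theorem gammaCoeff_eq (η : ℝ) (h1 : η < 1) (h0 : η ≠ 0) (n : ℕ) :
    gammaCoeff η n
      = -η * Real.Gamma (n - η) / (Real.Gamma (1 - η) * Real.Gamma (n + 1)) := by
  have hG : Real.Gamma (1 - η) ≠ 0 := (Real.Gamma_pos_of_pos (by linarith)).ne'
  have key : ∀ n : ℕ,
      (ascPochhammer ℝ n).eval (-η) * Real.Gamma (1 - η) = -η * Real.Gamma (n - η) := by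
    intro n
    induction n with
    | zero =>
      have := Real.Gamma_add_one (s := -η) (by simpa using h0)
      simp only [ascPochhammer_zero, Polynomial.eval_one, Nat.cast_zero, zero_sub, one_mul]
      rw [← this]; congr 1; ring
    | succ k ih =>
      have hk : (k : ℝ) - η ≠ 0 := by
        rcases Nat.eq_zero_or_pos k with rfl | hk
        · simpa using h0
        · have : (1 : ℝ) ≤ k := by exact_mod_cast hk
          linarith
      have := Real.Gamma_add_one hk
      rw [ascPochhammer_succ_eval, mul_right_comm, ih]
      have e : ((k + 1 : ℕ) : ℝ) - η = (k : ℝ) - η + 1 := by push_cast; ring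
      rw [e, this]; ring
  rw [gammaCoeff, Real.Gamma_nat_eq_factorial,
    div_eq_div_iff (by positivity) (mul_ne_zero hG (by positivity)), ← key n]
  ring

/-- `C_{n,R}`. -/
def C (α η : ℝ) (n R : ℕ) : ℝ :=
  gammaCoeff η n * nuHeightLE α η n R

/-- The generating function `H_R(ζ) = ∑ₙ C_{n,R} ζⁿ`. -/
def H (α η : ℝ) (R : ℕ) (ζ : ℝ) : ℝ :=
  ∑' n : ℕ, C α η n R * ζ ^ n

end

end AgModel

-- Every move raises the total weight of a tree by one, so a tree with `n` edges has total weight `n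
-- - η`, whatever its shape. The normalising factors of the chain are therefore deterministic and
-- multiply to the Pochhammer product in `gammaCoeff`. With `L` the unnormalised generator `gen`,
-- this gives `C_{n+1,R} = -η (Lⁿ 1_{h ≤ R})(edge) / (n+1)!` (`C_succ`). Hence `H_R' = -η G_R`,
-- where `G_R` is the value at the single edge of the formal solution `e^{tL} 1_{h ≤ R}` of the
-- backward equation `U' = L U`.
--
-- The solution at height `R + 1` is explicit in terms of the solution `U` at height `R`. As long as
-- the root edge is not grafted, the subtrees at the first vertex evolve independently and new ones
-- join at a rate affine in their number. This yields `P K^(k-1) ∏ U(Tᵢ)` for `k ≥ 1` subtrees, with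
-- `K = 1/H_R` and `P = H_R^((α-1)/η)`. Grafting the root edge of a tree `T` that is not a single
-- edge contributes `α (∫ P) U(T)`. The ansatz is verified in `derivative_nextLevel`, and formal
-- uniqueness (`eq_backward`) identifies it. At the single edge it expresses `G_{R+1}` by `H_R`, and
-- one integration gives the recursion for formal power series, `HSeries_succ`.
--
-- It remains to pass to functions. If `D < ∞` and `η ≠ 0`, then `(α-1)/η = D-2` is a natural
-- number, and all series converge everywhere. If `D = ∞` and `η > 0`, all weights are nonnegative,
-- and comparison with the process without height restriction, whose series is `(1-X)^η`, gives
-- convergence on `(-1,1)`, absolute summability at `±1`, and the lower bound `(1-y)^η ≤ H_R(y)` on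
-- `[0,1)`. The recursion then extends to `±1` by continuity. If `η = 0`, every `H_R` is `1`.

namespace AgModel

open PlantedTree PowerSeries

noncomputable section

/-! ### The generator of the growth process -/

section Generator

variable {M : Type*} [AddCommMonoid M] [Module ℝ M] (α η : ℝ)

/-- The generator of the growth process, acting on observables: the sum of the values of `f` at the
results of the moves from `T`, weighted by their relative probabilities. -/
def gen (f : PlantedTree → M) (T : PlantedTree) : M :=
  ((moves α η T).map fun m => m.2 • f m.1).sum

/-- The generator for lists of trees, in which one of the trees grows. -/
def genList (g : List PlantedTree → M) (cs : List PlantedTree) : M :=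
  ((movesList α η cs).map fun m => m.2 • g m.1).sum

theorem gen_node (f : PlantedTree → M) (cs : List PlantedTree) :
    gen α η f (node cs) = graftWeight α η cs • f (node [node cs]) +
      (((attachMoves α η cs).map fun m => m.2 • f m.1).sum +
        genList α η (fun l => f (node l)) cs) := by
  simp [gen, genList, moves, Function.comp_def]

@[simp] theorem genList_nil (g : List PlantedTree → M) : genList α η g [] = 0 := by
  simp [genList, movesList]

theorem genList_cons (g : List PlantedTree → M) (T : PlantedTree) (Ts : List PlantedTree) :
    genList α η g (T :: Ts) =
      gen α η (fun T' => g (T' :: Ts)) T + genList α η (fun l => g (T :: l)) Ts := by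
  simp [gen, genList, movesList, Function.comp_def]

theorem gen_edge (f : PlantedTree → M) :
    gen α η f (node []) = (1 - η) • f (node [node []]) := by
  simp [gen_node, graftWeight, attachMoves]

/-- If `f` does not see the position of the new edge, the equal shares of the attachment weight add
up to the whole weight. -/
theorem gen_node_of_ne_nil (f : PlantedTree → M) {cs : List PlantedTree} (hcs : cs ≠ []) {v : M}
    (hv : ∀ i ≤ cs.length, f (node (cs.insertIdx i (node []))) = v) :
    gen α η f (node cs) = α • f (node [node cs]) +
      (attachWeight α η (cs.length + 1) • v + genList α η (fun l => f (node l)) cs) := by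
  rw [gen_node]
  congr 2
  · simp [graftWeight, hcs]
  · rw [attachMoves, if_neg hcs, List.map_map]
    have : (List.range (cs.length + 1)).map ((fun m : PlantedTree × ℝ => m.2 • f m.1) ∘ fun i =>
        (node (cs.insertIdx i (node [])),
          attachWeight α η (cs.length + 1) / ((cs.length + 1 : ℕ) : ℝ))) =
        (List.range (cs.length + 1)).map fun _ =>
          (attachWeight α η (cs.length + 1) / ((cs.length + 1 : ℕ) : ℝ)) • v := by
      refine List.map_congr_left fun i hi => ?_
      rw [List.mem_range] at hi
      simp only [Function.comp_apply, hv i (by omega)]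
    rw [this, List.map_const', List.sum_replicate, List.length_range, ← Nat.cast_smul_eq_nsmul ℝ,
      smul_smul]
    congr 1
    field_simp

theorem length_of_mem_movesList (cs : List PlantedTree) :
    ∀ m ∈ movesList α η cs, m.1.length = cs.length := by
  induction cs with
  | nil => simp [movesList]
  | cons T Ts ih =>
    intro m hm
    rw [movesList, List.mem_append, List.mem_map, List.mem_map] at hm
    obtain ⟨a, -, rfl⟩ | ⟨a, ha, rfl⟩ := hm
    · simp
    · simp [ih a ha]

theorem gen_congr {f g : PlantedTree → M} {T : PlantedTree}
    (h : ∀ m ∈ moves α η T, f m.1 = g m.1) : gen α η f T = gen α η g T := by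
  unfold gen
  rw [List.map_congr_left fun m hm => by rw [h m hm]]

theorem genList_congr {f g : List PlantedTree → M} {cs : List PlantedTree}
    (h : ∀ l, l.length = cs.length → f l = g l) : genList α η f cs = genList α η g cs := by
  unfold genList
  rw [List.map_congr_left fun m hm => by rw [h _ (length_of_mem_movesList α η cs m hm)]]

theorem gen_add (f g : PlantedTree → M) (T : PlantedTree) :
    gen α η (fun T => f T + g T) T = gen α η f T + gen α η g T := by
  simp [gen, smul_add, List.sum_map_add]

theorem map_gen {N : Type*} [AddCommMonoid N] [Module ℝ N] (φ : M →ₗ[ℝ] N) (f : PlantedTree → M)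
    (T : PlantedTree) : φ (gen α η f T) = gen α η (fun T => φ (f T)) T := by
  simp [gen, map_list_sum, Function.comp_def]

theorem map_genList {N : Type*} [AddCommMonoid N] [Module ℝ N] (φ : M →ₗ[ℝ] N)
    (f : List PlantedTree → M) (cs : List PlantedTree) :
    φ (genList α η f cs) = genList α η (fun T => φ (f T)) cs := by
  simp [genList, map_list_sum, Function.comp_def]

variable {A : Type*} [CommRing A] [Algebra ℝ A]

theorem gen_const_mul (c : A) (f : PlantedTree → A) (T : PlantedTree) :
    gen α η (fun T => c * f T) T = c * gen α η f T :=
  (map_gen α η (LinearMap.mulLeft ℝ c) f T).symm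

theorem genList_const_mul (c : A) (f : List PlantedTree → A) (cs : List PlantedTree) :
    genList α η (fun T => c * f T) cs = c * genList α η f cs :=
  (map_genList α η (LinearMap.mulLeft ℝ c) f cs).symm

theorem gen_mul_const (c : A) (f : PlantedTree → A) (T : PlantedTree) :
    gen α η (fun T => f T * c) T = gen α η f T * c :=
  (map_gen α η (LinearMap.mulRight ℝ c) f T).symm

end Generator

/-! ### The total weight of the moves -/

section Weight

variable (α η : ℝ)

theorem planted_induction {p : PlantedTree → Prop}
    (h : ∀ cs, (∀ T ∈ cs, p T) → p (node cs)) : ∀ T, p T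
  | node cs => h cs fun T _ => planted_induction h T

/-- The sum of the relative probabilities of all moves. -/
def totalWeight (T : PlantedTree) : ℝ := gen α η (fun _ => (1 : ℝ)) T

theorem genList_one (cs : List PlantedTree) :
    genList α η (fun _ => (1 : ℝ)) cs = (cs.map (totalWeight α η)).sum := by
  induction cs with
  | nil => simp
  | cons T Ts ih => rw [genList_cons, ih]; simp [totalWeight]

theorem totalWeight_node (cs : List PlantedTree) :
    totalWeight α η (node cs) = 1 - η + (η * cs.length + (cs.map (totalWeight α η)).sum) := by
  rcases eq_or_ne cs [] with rfl | hcs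
  · simp [totalWeight, gen_edge]
  · rw [totalWeight, gen_node_of_ne_nil α η _ hcs (v := 1) (fun _ _ => rfl), genList_one,
      attachWeight]
    simp only [smul_eq_mul]
    push_cast
    ring

theorem totalWeight_of_mem_moves (T : PlantedTree) :
    ∀ m ∈ moves α η T, totalWeight α η m.1 = totalWeight α η T + 1 := by
  induction T using planted_induction with
  | h cs ih =>
  have hlist : ∀ l : List PlantedTree, (∀ T ∈ l, T ∈ cs) → ∀ m ∈ movesList α η l,
      (m.1.map (totalWeight α η)).sum = (l.map (totalWeight α η)).sum + 1 := by
    intro l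
    induction l with
    | nil => simp [movesList]
    | cons T Ts ihl =>
      intro hl m hm
      rw [movesList, List.mem_append, List.mem_map, List.mem_map] at hm
      obtain ⟨a, ha, rfl⟩ | ⟨a, ha, rfl⟩ := hm
      · simp only [List.map_cons, List.sum_cons]
        rw [ih T (hl T (by simp)) a ha]; ring
      · simp only [List.map_cons, List.sum_cons]
        rw [ihl (fun T hT => hl T (by simp [hT])) a ha]; ring
  intro m hm
  rw [moves, List.mem_cons, List.mem_append, List.mem_map] at hm
  obtain rfl | hm | ⟨a, ha, rfl⟩ := hm
  · rw [totalWeight_node α η [node cs]]; simp; ring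
  · rw [attachMoves] at hm
    split_ifs at hm with hcs
    · simp at hm
    · rw [List.mem_map] at hm
      obtain ⟨i, hi, rfl⟩ := hm
      rw [List.mem_range] at hi
      have hp : (cs.insertIdx i (node [])).Perm (node [] :: cs) :=
        List.perm_insertIdx _ _ (by omega)
      rw [totalWeight_node, totalWeight_node, hp.length_eq, (hp.map _).sum_eq]
      simp [totalWeight_node α η []]
      ring
  · rw [totalWeight_node, totalWeight_node, hlist cs (fun _ h => h) a ha,
      length_of_mem_movesList α η cs a ha]
    ring

end Weight

/-! ### The laws `ν_n` in terms of the generator -/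

section Law

variable (α η : ℝ)

/-- The expectation of `f` with respect to `ν_n`. -/
def nuExp (n : ℕ) (f : PlantedTree → ℝ) : ℝ := Finsupp.linearCombination ℝ f (nu α η n)

theorem linearCombination_transition (f : PlantedTree → ℝ) (T : PlantedTree) :
    Finsupp.linearCombination ℝ f (transition α η T) = (totalWeight α η T)⁻¹ * gen α η f T := by
  rw [transition, map_smul, map_list_sum, List.map_map]
  simp [totalWeight, gen, Function.comp_def, Finsupp.linearCombination_single]

theorem nuExp_succ (n : ℕ) (f : PlantedTree → ℝ) :
    nuExp α η (n + 3) f =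
      nuExp α η (n + 2) fun T => (totalWeight α η T)⁻¹ * gen α η f T := by
  rw [nuExp, nu, map_finsuppSum, nuExp, Finsupp.linearCombination_apply]
  simp only [map_smul, linearCombination_transition]

/-- The law at `n + 2` edges lives on trees of total weight `n + 2 - η`; this makes the
normalisation in each step a constant. -/
theorem nuExp_congr (n : ℕ) {f g : PlantedTree → ℝ}
    (h : ∀ T, totalWeight α η T = n + 2 - η → f T = g T) :
    nuExp α η (n + 2) f = nuExp α η (n + 2) g := by
  induction n generalizing f g with
  | zero =>
    simp only [nuExp, nu, Finsupp.linearCombination_single]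
    rw [h _ (by simp [totalWeight_node]; ring)]
  | succ n ih =>
    rw [nuExp_succ, nuExp_succ]
    refine ih fun T hT => ?_
    congr 1
    refine gen_congr α η fun m hm => h _ ?_
    rw [totalWeight_of_mem_moves α η T m hm, hT]
    push_cast
    ring

theorem nuExp_const_mul (n : ℕ) (c : ℝ) (f : PlantedTree → ℝ) :
    nuExp α η n (fun T => c * f T) = c * nuExp α η n f := by
  simp only [nuExp, Finsupp.linearCombination_apply, Finsupp.sum, Finset.mul_sum, smul_eq_mul]
  exact Finset.sum_congr rfl fun _ _ => by ring

/-- Each step of the chain divides by the next Pochhammer factor. The factor `1 - η`, which may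
vanish, is never divided by: it is the weight of the only move from the single edge. -/
theorem ascPochhammer_mul_nuExp (hη : η ≤ 1) (n : ℕ) (f : PlantedTree → ℝ) :
    (ascPochhammer ℝ (n + 2)).eval (-η) * nuExp α η (n + 2) f =
      -η * (gen α η)^[n + 1] f (node []) := by
  induction n generalizing f with
  | zero =>
    simp [nuExp, nu, Finsupp.linearCombination_single, ascPochhammer_succ_eval, gen_edge]
    ring
  | succ n ih =>
    have hn : (n : ℝ) + 2 - η ≠ 0 := by
      have : (0 : ℝ) ≤ n := n.cast_nonneg
      linarith
    rw [nuExp_succ, nuExp_congr α η n (g := fun T => ((n : ℝ) + 2 - η)⁻¹ * gen α η f T)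
      (fun T hT => by rw [hT]), nuExp_const_mul, ascPochhammer_succ_eval,
      Function.iterate_succ_apply, ← ih (gen α η f)]
    push_cast
    field_simp
    ring

end Law

/-! ### The generating functions as formal power series -/

section Formal

variable (α η : ℝ)

/-- The indicator function of the trees of height at most `R`. -/
def heightInd (R : ℕ) (T : PlantedTree) : ℝ := if height T ≤ R then 1 else 0

/-- The formal solution of the backward equation for the growth process with initial value `f`. -/
def backward (f : PlantedTree → ℝ) (T : PlantedTree) : ℝ⟦X⟧ :=
  PowerSeries.mk fun n => (gen α η)^[n] f T / n.factorial

theorem derivative_backward (f : PlantedTree → ℝ) (T : PlantedTree) :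
    d⁄dX ℝ (backward α η f T) = gen α η (backward α η f) T := by
  ext n
  rw [map_gen α η (PowerSeries.coeff n), coeff_derivative]
  simp only [backward, coeff_mk, Function.iterate_succ_apply', div_eq_mul_inv, gen_mul_const]
  rw [Nat.factorial_succ]
  push_cast
  field_simp

/-- The equation determines the coefficient of order `n + 1` from those of order `n`. -/
theorem eq_backward {f : PlantedTree → ℝ} {W : PlantedTree → ℝ⟦X⟧}
    (h0 : ∀ T, constantCoeff (W T) = f T) (hW : ∀ T, d⁄dX ℝ (W T) = gen α η W T) :
    W = backward α η f := by
  suffices ∀ n T, coeff n (W T) = (gen α η)^[n] f T / n.factorial by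
    funext T; ext n; simp [this, backward]
  intro n
  induction n with
  | zero => simpa using h0
  | succ n ih =>
    intro T
    have := congrArg (coeff n) (hW T)
    rw [map_gen α η (PowerSeries.coeff n), coeff_derivative] at this
    simp only [ih, div_eq_mul_inv, gen_mul_const] at this
    rw [Function.iterate_succ_apply', Nat.factorial_succ]
    push_cast
    field_simp at this ⊢
    linarith

/-- The formal power series `∑ₙ C_{n,R} Xⁿ`. -/
def HSeries (R : ℕ) : ℝ⟦X⟧ := PowerSeries.mk fun n => C α η n R

theorem C_zero (R : ℕ) : C α η 0 R = 1 := by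
  simp [C, gammaCoeff, nuHeightLE]

theorem C_succ (hη : η ≤ 1) (n R : ℕ) :
    C α η (n + 1) R = -η * (gen α η)^[n] (heightInd R) (node []) / (n + 1).factorial := by
  have h : nuHeightLE α η (n + 1) R = nuExp α η (n + 1) (heightInd R) := by
    simp only [nuHeightLE, nuExp, Finsupp.linearCombination_apply, heightInd]
    simp
  rw [C, gammaCoeff, h, div_mul_eq_mul_div]
  congr 1
  cases n with
  | zero => simp [nuExp, nu, Finsupp.linearCombination_single]
  | succ n => exact ascPochhammer_mul_nuExp α η hη n _

theorem constantCoeff_HSeries (R : ℕ) : constantCoeff (HSeries α η R) = 1 := by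
  rw [← coeff_zero_eq_constantCoeff_apply, HSeries, coeff_mk, C_zero]

theorem derivative_HSeries (hη : η ≤ 1) (R : ℕ) :
    d⁄dX ℝ (HSeries α η R) = (-η) • backward α η (heightInd R) (node []) := by
  ext n
  rw [coeff_derivative]
  simp only [HSeries, backward, coeff_mk, C_succ α η hη, coeff_smul, smul_eq_mul]
  rw [Nat.factorial_succ]
  push_cast
  field_simp

/-- The formal antiderivative without constant term. -/
def antideriv (S : ℝ⟦X⟧) : ℝ⟦X⟧ :=
  PowerSeries.mk fun n => match n with
    | 0 => 0
    | n + 1 => coeff n S / (n + 1)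

@[simp] theorem derivative_antideriv (S : ℝ⟦X⟧) : d⁄dX ℝ (antideriv S) = S := by
  ext n
  rw [coeff_derivative, antideriv, coeff_mk]
  field_simp

@[simp] theorem constantCoeff_antideriv (S : ℝ⟦X⟧) : constantCoeff (antideriv S) = 0 := by
  rw [← coeff_zero_eq_constantCoeff_apply, antideriv, coeff_mk]

/-- The Leibniz rule differentiates one factor at a time, just as a move in a list changes one tree.
-/
theorem derivative_prod {U : PlantedTree → ℝ⟦X⟧} (hU : ∀ T, d⁄dX ℝ (U T) = gen α η U T)
    (cs : List PlantedTree) :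
    d⁄dX ℝ (cs.map U).prod = genList α η (fun l => (l.map U).prod) cs := by
  induction cs with
  | nil => simp
  | cons T Ts ih =>
    rw [genList_cons]
    simp only [List.map_cons, List.prod_cons]
    rw [Derivation.leibniz, ih, hU, genList_const_mul, gen_mul_const]
    simp only [smul_eq_mul]
    ring

/-- The part of the solution of the backward equation, at the next height, that comes from the
histories without grafting to the root edge. -/
def ungrafted (P K : ℝ⟦X⟧) (U : PlantedTree → ℝ⟦X⟧) (cs : List PlantedTree) : ℝ⟦X⟧ :=
  P * K ^ (cs.length - 1) * (cs.map U).prod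

/-- The solution of the backward equation at the next height, expressed by the solution `U` at the
present height. -/
def nextLevel (P K : ℝ⟦X⟧) (U : PlantedTree → ℝ⟦X⟧) : PlantedTree → ℝ⟦X⟧
  | node [] => 1 + α • (antideriv P * U (node [])) +
      (1 - η - α) • antideriv (U (node []) * P)
  | node (c :: cs) => ungrafted P K U (c :: cs) + α • (antideriv P * U (node (c :: cs)))

theorem nextLevel_of_ne_nil (P K : ℝ⟦X⟧) (U : PlantedTree → ℝ⟦X⟧) {cs : List PlantedTree}
    (hcs : cs ≠ []) :
    nextLevel α η P K U (node cs) =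
      ungrafted P K U cs + α • (antideriv P * U (node cs)) := by
  cases cs with
  | nil => exact absurd rfl hcs
  | cons c cs => rfl

variable {α η}

/-- The equations for `P` and `K` are chosen so that `P K^(k-1)` has derivative `(1 - α + η (k-1)) G
P K^k` with `G = U (node [])`; the scalar is the attachment weight of a vertex with `k` children.
Differentiating `antideriv P` produces the grafting term `α P U`. -/
theorem derivative_nextLevel {P K : ℝ⟦X⟧} {U : PlantedTree → ℝ⟦X⟧}
    (hU : ∀ T, d⁄dX ℝ (U T) = gen α η U T)
    (hP : d⁄dX ℝ P = (1 - α) • (U (node []) * K * P))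
    (hK : d⁄dX ℝ K = η • (U (node []) * K ^ 2)) (T : PlantedTree) :
    d⁄dX ℝ (nextLevel α η P K U T) = gen α η (nextLevel α η P K U) T := by
  obtain ⟨cs⟩ := T
  rcases eq_or_ne cs [] with rfl | hcs
  · have h := hU (node [])
    rw [gen_edge] at h
    rw [gen_edge, nextLevel_of_ne_nil α η P K U (cs := [node []]) (by simp), nextLevel, ungrafted]
    simp only [map_add, Derivation.map_smul, Derivation.leibniz, Derivation.map_one_eq_zero,
      derivative_antideriv, h]
    simp only [smul_eq_C_mul, smul_eq_mul, List.length_singleton, List.map_cons, List.map_nil,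
      List.prod_cons, List.prod_nil, map_sub, map_one, Nat.sub_self, pow_zero]
    ring
  · obtain ⟨k, hk⟩ : ∃ k, cs.length = k + 1 :=
      Nat.exists_eq_succ_of_ne_zero (by simpa using hcs)
    -- The definition at `node []` is exceptional, but no move from a tree with children leads
    -- there, so one formula can be used for all results of moves.
    let V : PlantedTree → ℝ⟦X⟧ := fun T => match T with
      | node l => ungrafted P K U l
    have hsplit : gen α η (nextLevel α η P K U) (node cs) =
        gen α η (fun T => V T + α • (antideriv P * U T)) (node cs) := by
      refine gen_congr α η fun m hm => ?_
      have hne : ∃ l, l ≠ [] ∧ m.1 = node l := by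
        rw [moves, List.mem_cons, List.mem_append, List.mem_map] at hm
        obtain rfl | hm | ⟨a, ha, rfl⟩ := hm
        · exact ⟨_, by simp, rfl⟩
        · rw [attachMoves, if_neg hcs, List.mem_map] at hm
          obtain ⟨i, hi, rfl⟩ := hm
          rw [List.mem_range] at hi
          refine ⟨_, ?_, rfl⟩
          rw [← List.length_pos_iff_ne_nil, List.length_insertIdx]
          split_ifs <;> omega
        · refine ⟨_, ?_, rfl⟩
          rw [← List.length_pos_iff_ne_nil, length_of_mem_movesList α η cs a ha]
          omega
      obtain ⟨l, hl, hm1⟩ := hne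
      rw [hm1, nextLevel_of_ne_nil _ _ _ _ _ hl]
    have hV : gen α η V (node cs) = α • (P * U (node cs)) +
        (attachWeight α η (cs.length + 1) • (P * K ^ (k + 1) * (U (node []) * (cs.map U).prod)) +
          P * K ^ k * genList α η (fun l => (l.map U).prod) cs) := by
      rw [gen_node_of_ne_nil α η V hcs
        (v := P * K ^ (k + 1) * (U (node []) * (cs.map U).prod)) ?_]
      · congr 2
        · simp [V, ungrafted]
        · rw [← genList_const_mul]
          refine genList_congr α η fun l hl => ?_
          simp [V, ungrafted, hl, hk]
      · intro i hi
        have hp : (cs.insertIdx i (node [])).Perm (node [] :: cs) :=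
          List.perm_insertIdx _ _ hi
        simp only [V, ungrafted]
        rw [hp.length_eq, (hp.map _).prod_eq]
        simp [hk]
    have hsm : gen α η (fun T => α • (antideriv P * U T)) (node cs) =
        α • (antideriv P * gen α η U (node cs)) := by
      simp only [smul_eq_C_mul, gen_const_mul]
    rw [hsplit, gen_add, hV, hsm, nextLevel_of_ne_nil _ _ _ _ _ hcs, ungrafted]
    simp only [map_add, Derivation.map_smul, Derivation.leibniz, Derivation.leibniz_pow,
      derivative_antideriv, hU, hP, hK, derivative_prod α η hU]
    simp only [smul_eq_C_mul, smul_eq_mul, attachWeight, hk, nsmul_eq_mul, Nat.add_sub_cancel]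
    -- The exponent `k - 1` is truncated at `k = 0`, where the factor `k` vanishes.
    have hpow : (k : ℝ⟦X⟧) * (K ^ (k - 1) * K ^ 2) = k * K ^ (k + 1) := by
      cases k with
      | zero => simp
      | succ k => rw [← pow_add]; simp
    have hc : (k : ℝ⟦X⟧) = PowerSeries.C (k : ℝ) := by simp
    simp only [map_add, map_sub, map_mul, map_one, Nat.cast_add, Nat.cast_one, map_ofNat, ← hc]
    linear_combination (PowerSeries.C η * P * U (node []) * (cs.map U).prod) * hpow

theorem heightList_le (cs : List PlantedTree) (R : ℕ) :
    heightList cs ≤ R ↔ ∀ T ∈ cs, height T ≤ R := by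
  induction cs with
  | nil => simp [heightList]
  | cons T Ts ih => simp [heightList, ih]

theorem heightInd_succ_node (R : ℕ) (cs : List PlantedTree) :
    heightInd (R + 1) (node cs) = (cs.map (heightInd R)).prod := by
  have h : heightInd (R + 1) (node cs) = if ∀ T ∈ cs, height T ≤ R then 1 else 0 := by
    simp [heightInd, height, heightList_le]
  rw [h]
  clear h
  induction cs with
  | nil => simp
  | cons T Ts ih =>
    rw [List.map_cons, List.prod_cons, ← ih]
    clear ih
    simp only [heightInd, List.forall_mem_cons]
    split_ifs <;> simp_all

theorem constantCoeff_backward (f : PlantedTree → ℝ) (T : PlantedTree) :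
    constantCoeff (backward α η f T) = f T := by
  rw [← coeff_zero_eq_constantCoeff_apply, backward, coeff_mk]
  simp

theorem constantCoeff_nextLevel {P K : ℝ⟦X⟧} (hP0 : constantCoeff P = 1)
    (hK0 : constantCoeff K = 1) (R : ℕ) (T : PlantedTree) :
    constantCoeff (nextLevel α η P K (backward α η (heightInd R)) T) = heightInd (R + 1) T := by
  obtain ⟨cs⟩ := T
  rw [heightInd_succ_node]
  rcases eq_or_ne cs [] with rfl | hcs
  · simp [nextLevel, smul_eq_C_mul]
  · rw [nextLevel_of_ne_nil _ _ _ _ _ hcs, ungrafted]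
    simp only [map_add, map_mul, map_pow, hP0, hK0, one_pow, one_mul, smul_eq_C_mul,
      constantCoeff_antideriv, zero_mul, mul_zero, add_zero, map_list_prod, List.map_map]
    congr 1
    exact List.map_congr_left fun T _ => constantCoeff_backward _ _

/-- The recursion for the generating functions, for formal power series. The series `P` is the
formal power `H_R ^ ((α - 1) / η)`. -/
theorem HSeries_succ (hη : η ≤ 1) (R : ℕ) {P : ℝ⟦X⟧} (hP0 : constantCoeff P = 1)
    (hP : HSeries α η R * d⁄dX ℝ P = (1 - α) • (backward α η (heightInd R) (node []) * P)) :
    HSeries α η (R + 1) = 1 + α • (HSeries α η R * antideriv P) -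
      (α + η) • antideriv (HSeries α η R * P) := by
  set G := backward α η (heightInd R) (node []) with hG
  set H := HSeries α η R with hH
  have hH0 : constantCoeff H = 1 := constantCoeff_HSeries α η R
  have hH' : d⁄dX ℝ H = (-η) • G := derivative_HSeries α η hη R
  have hHK : H * H⁻¹ = 1 := PowerSeries.mul_inv_cancel _ (by simp [hH0])
  have hP' : d⁄dX ℝ P = (1 - α) • (G * H⁻¹ * P) := by
    calc d⁄dX ℝ P = H⁻¹ * (H * d⁄dX ℝ P) := by rw [← mul_assoc, mul_comm H⁻¹, hHK, one_mul]
      _ = _ := by rw [hP, smul_eq_C_mul, smul_eq_C_mul]; ring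
  have hK' : d⁄dX ℝ H⁻¹ = η • (G * H⁻¹ ^ 2) := by
    rw [derivative_inv', hH']
    simp only [smul_eq_C_mul, map_neg]
    ring
  have hW : nextLevel α η P H⁻¹ (backward α η (heightInd R)) =
      backward α η (heightInd (R + 1)) :=
    eq_backward α η (constantCoeff_nextLevel hP0 (by simp [hH0]) R)
      (derivative_nextLevel (derivative_backward α η _) hP' hK')
  have hG' : backward α η (heightInd (R + 1)) (node []) =
      1 + α • (antideriv P * G) + (1 - η - α) • antideriv (G * P) := by
    rw [← hW, nextLevel]
  -- Both sides have constant term `1` and derivative `(1 - α - η) G P`. Thus `G_{R+1} = H P + α (∫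
  -- P) G`, which is integrated below using `H' = -η G`.
  have hHP : H * P = 1 + (1 - α - η) • antideriv (G * P) := by
    refine derivative.ext ?_ (by simp [hH0, hP0, smul_eq_C_mul])
    simp only [map_add, Derivation.map_smul, Derivation.leibniz, Derivation.map_one_eq_zero,
      derivative_antideriv, hH', smul_eq_mul, hP]
    simp only [smul_eq_C_mul, map_sub, map_one, map_neg]
    ring
  refine derivative.ext ?_ (by
    simp [constantCoeff_HSeries, smul_eq_C_mul])
  rw [derivative_HSeries α η hη, hG']
  simp only [map_add, map_sub, Derivation.map_smul, Derivation.leibniz,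
    Derivation.map_one_eq_zero, derivative_antideriv, hH', smul_eq_mul]
  simp only [smul_eq_C_mul, map_sub, map_one, map_neg, map_add] at hHP ⊢
  linear_combination PowerSeries.C η * hHP

end Formal

/-! ### Evaluation of power series -/

section Evaluation

/-- The power series converges absolutely in the open interval `(-r, r)`. -/
def ConvergesOn (r : ℝ) (S : ℝ⟦X⟧) : Prop :=
  ∀ ρ, 0 ≤ ρ → ρ < r → Summable fun n => |coeff n S| * ρ ^ n

/-- The sum of a power series at `y`. -/
def evalAt (S : ℝ⟦X⟧) (y : ℝ) : ℝ := ∑' n, coeff n S * y ^ n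

variable {r : ℝ} {S S' : ℝ⟦X⟧}

theorem ConvergesOn.summable_norm (h : ConvergesOn r S) {y : ℝ} (hy : |y| < r) :
    Summable fun n => ‖coeff n S * y ^ n‖ := by
  simpa [abs_mul, abs_pow] using h |y| (abs_nonneg y) hy

theorem ConvergesOn.of_summable_norm
    (h : ∀ y, 0 ≤ y → y < r → Summable fun n => ‖coeff n S * y ^ n‖) : ConvergesOn r S := by
  intro y h0 hy
  have := h y h0 hy
  simpa [abs_mul, abs_pow, abs_of_nonneg h0] using this

theorem ConvergesOn.summable (h : ConvergesOn r S) {y : ℝ} (hy : |y| < r) :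
    Summable fun n => coeff n S * y ^ n :=
  (h.summable_norm hy).of_norm

theorem ConvergesOn.add (h : ConvergesOn r S) (h' : ConvergesOn r S') :
    ConvergesOn r (S + S') := by
  intro ρ h0 hρ
  refine ((h ρ h0 hρ).add (h' ρ h0 hρ)).of_nonneg_of_le (fun n => by positivity) fun n => ?_
  rw [← add_mul, map_add]
  gcongr
  exact abs_add_le _ _

theorem ConvergesOn.smul (h : ConvergesOn r S) (a : ℝ) : ConvergesOn r (a • S) := by
  intro ρ h0 hρ
  simpa [abs_mul, mul_assoc] using (h ρ h0 hρ).mul_left |a|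

theorem ConvergesOn.one : ConvergesOn r 1 := by
  intro ρ _ _
  refine summable_of_ne_finset_zero (s := {0}) fun n hn => ?_
  rw [coeff_one, if_neg (by simpa using hn)]
  simp

theorem evalAt_one (y : ℝ) : evalAt 1 y = 1 := by
  rw [evalAt, tsum_eq_single 0]
  · simp
  · intro n hn
    rw [coeff_one, if_neg hn, zero_mul]

theorem evalAt_zero (S : ℝ⟦X⟧) : evalAt S 0 = constantCoeff S := by
  rw [evalAt, tsum_eq_single 0]
  · simp
  · intro n hn
    simp [hn]

theorem evalAt_smul (a : ℝ) (S : ℝ⟦X⟧) (y : ℝ) : evalAt (a • S) y = a * evalAt S y := by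
  simp [evalAt, mul_assoc, tsum_mul_left]

theorem evalAt_add (h : ConvergesOn r S) (h' : ConvergesOn r S') {y : ℝ} (hy : |y| < r) :
    evalAt (S + S') y = evalAt S y + evalAt S' y := by
  simp only [evalAt, map_add, add_mul]
  exact (h.summable hy).tsum_add (h'.summable hy)

theorem coeff_mul_mul_pow (S S' : ℝ⟦X⟧) (y : ℝ) (n : ℕ) :
    coeff n (S * S') * y ^ n = ∑ kl ∈ Finset.HasAntidiagonal.antidiagonal n,
      coeff kl.1 S * y ^ kl.1 * (coeff kl.2 S' * y ^ kl.2) := by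
  rw [coeff_mul, Finset.sum_mul]
  refine Finset.sum_congr rfl fun kl hkl => ?_
  rw [← Finset.HasAntidiagonal.mem_antidiagonal.1 hkl, pow_add]
  ring

theorem ConvergesOn.mul (h : ConvergesOn r S) (h' : ConvergesOn r S') :
    ConvergesOn r (S * S') := by
  refine ConvergesOn.of_summable_norm fun y h0 hy => ?_
  have hy' : |y| < r := by rwa [abs_of_nonneg h0]
  have key := summable_norm_sum_mul_antidiagonal_of_summable_norm (h.summable_norm hy')
    (h'.summable_norm hy')
  refine key.congr fun n => ?_
  rw [coeff_mul_mul_pow]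

theorem evalAt_mul (h : ConvergesOn r S) (h' : ConvergesOn r S') {y : ℝ} (hy : |y| < r) :
    evalAt (S * S') y = evalAt S y * evalAt S' y := by
  simp only [evalAt, coeff_mul_mul_pow]
  exact (tsum_mul_tsum_eq_tsum_sum_antidiagonal_of_summable_norm (h.summable_norm hy)
    (h'.summable_norm hy)).symm

theorem ConvergesOn.pow (h : ConvergesOn r S) (k : ℕ) : ConvergesOn r (S ^ k) := by
  induction k with
  | zero => simpa using ConvergesOn.one
  | succ k ih => rw [pow_succ]; exact ih.mul h

theorem evalAt_pow (h : ConvergesOn r S) {y : ℝ} (hy : |y| < r) (k : ℕ) :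
    evalAt (S ^ k) y = evalAt S y ^ k := by
  induction k with
  | zero => simp [evalAt_one]
  | succ k ih => rw [pow_succ, pow_succ, evalAt_mul (h.pow k) h hy, ih]

theorem ConvergesOn.antideriv (h : ConvergesOn r S) : ConvergesOn r (antideriv S) := by
  intro ρ h0 hρ
  rw [← summable_nat_add_iff 1]
  refine ((h ρ h0 hρ).mul_right ρ).of_nonneg_of_le (fun n => by positivity) fun n => ?_
  rw [AgModel.antideriv, coeff_mk, pow_succ, ← mul_assoc, abs_div]
  gcongr
  refine div_le_self (abs_nonneg _) ?_
  rw [abs_of_nonneg (by positivity)]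
  linarith [n.cast_nonneg (α := ℝ)]

theorem ConvergesOn.summable_derivative (h : ConvergesOn r S) {ρ : ℝ} (h0 : 0 ≤ ρ) (hρ : ρ < r) :
    Summable fun n => |coeff n S| * (n * ρ ^ (n - 1)) := by
  -- At a slightly larger radius `σ`, the factor `n` is absorbed because `n (ρ/σ)^n` is bounded.
  obtain ⟨σ, hσ, hσr⟩ := exists_between hρ
  have hσ0 : 0 < σ := h0.trans_lt hσ
  have hq : ‖ρ / σ‖ < 1 := by
    rw [Real.norm_of_nonneg (by positivity)]
    exact (div_lt_one hσ0).2 hσ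
  have hb := (summable_pow_mul_geometric_of_norm_lt_one 1 hq).tendsto_atTop_zero.bddAbove_range
  obtain ⟨B, hB⟩ := hb
  rw [← summable_nat_add_iff 1]
  have hs := ((summable_nat_add_iff 1).2 (h σ hσ0.le hσr)).mul_left ((B + 1) / σ)
  refine hs.of_nonneg_of_le (fun n => by positivity) fun n => ?_
  have h1 := hB ⟨n, rfl⟩
  simp only [pow_one] at h1
  have h2 : (ρ / σ) ^ n ≤ 1 := pow_le_one₀ (by positivity) ((div_le_one hσ0).2 hσ.le)
  have h3 : ((n + 1 : ℕ) : ℝ) * ρ ^ n ≤ (B + 1) * σ ^ n := by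
    rw [div_pow, mul_div_assoc', div_le_iff₀ (by positivity)] at h1
    rw [div_pow, div_le_iff₀ (by positivity)] at h2
    push_cast
    linarith
  simp only [Nat.add_sub_cancel]
  calc |coeff (n + 1) S| * (((n + 1 : ℕ) : ℝ) * ρ ^ n)
      ≤ |coeff (n + 1) S| * ((B + 1) * σ ^ n) := by gcongr
    _ = (B + 1) / σ * (|coeff (n + 1) S| * σ ^ (n + 1)) := by
        rw [pow_succ]; field_simp

theorem ConvergesOn.derivative (h : ConvergesOn r S) : ConvergesOn r (d⁄dX ℝ S) := by
  intro ρ h0 hρ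
  have := (summable_nat_add_iff 1).2 (h.summable_derivative h0 hρ)
  refine this.congr fun n => ?_
  rw [coeff_derivative, abs_mul, abs_of_nonneg (by positivity : (0 : ℝ) ≤ n + 1)]
  simp only [Nat.add_sub_cancel]
  push_cast
  ring

theorem ConvergesOn.hasDerivAt (h : ConvergesOn r S) {y : ℝ} (hy : |y| < r) :
    HasDerivAt (evalAt S) (evalAt (d⁄dX ℝ S) y) y := by
  obtain ⟨ρ, hyρ, hρ⟩ := exists_between hy
  have h0 : 0 < ρ := (abs_nonneg y).trans_lt hyρ
  have key := hasDerivAt_tsum_of_isPreconnected (t := Set.Ioo (-ρ) ρ)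
    (g := fun n y => coeff n S * y ^ n) (g' := fun n y => coeff n S * (n * y ^ (n - 1)))
    (h.summable_derivative h0.le hρ) isOpen_Ioo isPreconnected_Ioo
    (fun n y _ => (hasDerivAt_pow n y).const_mul _) (fun n z hz => ?_)
    (y₀ := 0) (by simp [h0]) (h.summable (by simpa using h0.trans hρ)) (abs_lt.1 hyρ)
  · have e : ∑' n, coeff n S * (n * y ^ (n - 1)) = evalAt (d⁄dX ℝ S) y := by
      rw [Summable.tsum_eq_zero_add]
      · simp only [evalAt, coeff_derivative]
        simp [mul_assoc]
      · refine Summable.of_norm ?_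
        simpa [abs_mul, abs_pow] using h.summable_derivative (abs_nonneg y) hy
    rw [← e]
    exact key
  · rw [Real.norm_eq_abs, abs_mul, abs_mul, abs_pow, Nat.abs_cast]
    gcongr
    exact (abs_lt.2 hz).le

theorem ConvergesOn.continuousOn (h : ConvergesOn r S) :
    ContinuousOn (evalAt S) {y | |y| < r} :=
  fun _ hy => (h.hasDerivAt hy).continuousAt.continuousWithinAt

theorem abs_lt_of_mem_uIcc {y z : ℝ} (hz : |z| < r) (hy : y ∈ Set.uIcc 0 z) : |y| < r := by
  refine lt_of_le_of_lt ?_ hz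
  simpa using Set.abs_sub_left_of_mem_uIcc hy

theorem integral_evalAt (h : ConvergesOn r S) {z : ℝ} (hz : |z| < r) :
    ∫ y in (0 : ℝ)..z, evalAt S y = evalAt (antideriv S) z := by
  rw [intervalIntegral.integral_eq_sub_of_hasDerivAt (f := evalAt (antideriv S))]
  · simp [evalAt_zero]
  · intro y hy
    simpa using h.antideriv.hasDerivAt (abs_lt_of_mem_uIcc hz hy)
  · exact (h.continuousOn.mono fun y hy => abs_lt_of_mem_uIcc hz hy).intervalIntegrable

/-- A series that satisfies the differential equation of the `p`-th power of `S` is the `p`-th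
power of `S`. -/
theorem evalAt_eq_rpow {P : ℝ⟦X⟧} {p : ℝ} (hS : ConvergesOn r S) (hP : ConvergesOn r P)
    (hpos : ∀ y, |y| < r → 0 < evalAt S y) (hS0 : constantCoeff S = 1)
    (hP0 : constantCoeff P = 1) (hd : S * d⁄dX ℝ P = p • (d⁄dX ℝ S * P)) {y : ℝ}
    (hy : |y| < r) : evalAt P y = evalAt S y ^ p := by
  have hr : 0 < r := (abs_nonneg y).trans_lt hy
  -- The quotient of the two candidates has derivative zero and equals `1` at the origin.
  have hφ : ∀ z ∈ Set.Ioo (-r) r,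
      HasDerivAt (fun z => evalAt P z * evalAt S z ^ (-p)) 0 z := by
    intro z hz
    have hz' := abs_lt.2 hz
    have hne := (hpos z hz').ne'
    have h1 := (hP.hasDerivAt hz').mul ((hS.hasDerivAt hz').rpow_const (p := -p) (Or.inl hne))
    refine h1.congr_deriv ?_
    have e := congrArg (fun T => evalAt T z) hd
    simp only [evalAt_smul] at e
    rw [evalAt_mul hS hP.derivative hz', evalAt_mul hS.derivative hP hz'] at e
    have hp : evalAt S z ^ (-p) = evalAt S z ^ (-p - 1) * evalAt S z := by
      rw [← Real.rpow_add_one hne]; congr 1; ring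
    rw [hp]
    linear_combination evalAt S z ^ (-p - 1) * e
  have hc := isOpen_Ioo.is_const_of_deriv_eq_zero isPreconnected_Ioo
    (fun z hz => (hφ z hz).differentiableAt.differentiableWithinAt)
    (fun z hz => (hφ z hz).deriv) (abs_lt.1 hy) (y := 0) (by simp [hr])
  simp only [evalAt_zero, hS0, hP0, Real.one_rpow, mul_one] at hc
  have hpy := hpos y hy
  rw [Real.rpow_neg hpy.le] at hc
  exact eq_of_mul_inv_eq_one hc

end Evaluation

/-! ### Transfer of the recursion to functions -/

section Transfer

variable {α η : ℝ}

theorem H_eq_evalAt (R : ℕ) (y : ℝ) : H α η R y = evalAt (HSeries α η R) y := by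
  simp [H, evalAt, HSeries]

theorem height_pos (T : PlantedTree) : 0 < height T := by
  obtain ⟨cs⟩ := T
  simp [height]

theorem HSeries_zero : HSeries α η 0 = 1 := by
  ext n
  rw [HSeries, coeff_mk, coeff_one]
  rcases eq_or_ne n 0 with rfl | hn
  · simp [C_zero]
  · have : ∀ T, ¬ height T ≤ 0 := fun T => by have := height_pos T; omega
    simp [C, nuHeightLE, hn, this]

theorem HSeries_eq_one (R : ℕ) : HSeries α 0 R = 1 := by
  ext n
  rw [HSeries, coeff_mk, coeff_one]
  cases n with
  | zero => simp [C_zero]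
  | succ n => simp [C_succ α 0 zero_le_one]

/-- The recursion at a point inside the interval of convergence. -/
theorem H_succ {r : ℝ} (hη : η ≤ 1) (R : ℕ) {P : ℝ⟦X⟧} (hH : ConvergesOn r (HSeries α η R))
    (hPc : ConvergesOn r P) (hP0 : constantCoeff P = 1)
    (hP : HSeries α η R * d⁄dX ℝ P = (1 - α) • (backward α η (heightInd R) (node []) * P))
    (h1 : ∀ y, |y| < r → evalAt P y = H α η R y ^ ((α - 1) / η))
    (h2 : ∀ y, |y| < r → H α η R y * evalAt P y = H α η R y ^ ((α + η - 1) / η))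
    {z : ℝ} (hz : |z| < r) :
    H α η (R + 1) z = 1 + α * H α η R z * (∫ y in (0 : ℝ)..z, H α η R y ^ ((α - 1) / η)) -
      (α + η) * ∫ y in (0 : ℝ)..z, H α η R y ^ ((α + η - 1) / η) := by
  have e1 : ∫ y in (0 : ℝ)..z, H α η R y ^ ((α - 1) / η) = evalAt (antideriv P) z := by
    rw [← integral_evalAt hPc hz]
    exact intervalIntegral.integral_congr fun y hy => (h1 y (abs_lt_of_mem_uIcc hz hy)).symm
  have e2 : ∫ y in (0 : ℝ)..z, H α η R y ^ ((α + η - 1) / η) =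
      evalAt (antideriv (HSeries α η R * P)) z := by
    rw [← integral_evalAt (hH.mul hPc) hz]
    refine intervalIntegral.integral_congr fun y hy => ?_
    have hy' := abs_lt_of_mem_uIcc hz hy
    rw [← h2 y hy', evalAt_mul hH hPc hy', H_eq_evalAt]
  rw [e1, e2, H_eq_evalAt, HSeries_succ hη R hP0 hP, sub_eq_add_neg, ← neg_smul,
    evalAt_add (ConvergesOn.one.add ((hH.mul hPc.antideriv).smul α))
      ((hH.mul hPc).antideriv.smul _) hz,
    evalAt_add ConvergesOn.one ((hH.mul hPc.antideriv).smul α) hz, evalAt_one, evalAt_smul,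
    evalAt_smul, evalAt_mul hH hPc.antideriv hz, H_eq_evalAt]
  ring

end Transfer

/-! ### Bounded degrees -/

section Bounded

variable {α η : ℝ}

theorem HSeries_mul_derivative_pow (hη : η ≤ 1) {m : ℕ} (hm : 1 - α = -(m * η)) (R : ℕ) :
    HSeries α η R * d⁄dX ℝ (HSeries α η R ^ m) =
      (1 - α) • (backward α η (heightInd R) (node []) * HSeries α η R ^ m) := by
  cases m with
  | zero => simp [hm]
  | succ m =>
    rw [derivative_pow, derivative_HSeries α η hη, hm]
    have hc : ((m + 1 : ℕ) : ℝ⟦X⟧) = PowerSeries.C ((m + 1 : ℕ) : ℝ) := by simp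
    rw [hc]
    simp only [smul_eq_C_mul, map_neg, map_mul, Nat.add_sub_cancel]
    ring

/-- With `P = H_R ^ m`, the formal recursion uses only sums, products and antiderivatives, which
preserve any radius `r`. -/
theorem convergesOn_HSeries_of_nat (hη : η ≤ 1) {m : ℕ} (hm : 1 - α = -(m * η)) (r : ℝ) (R : ℕ) :
    ConvergesOn r (HSeries α η R) := by
  induction R with
  | zero => rw [HSeries_zero]; exact ConvergesOn.one
  | succ R ih =>
    rw [HSeries_succ hη R (P := HSeries α η R ^ m) (by simp [constantCoeff_HSeries])
      (HSeries_mul_derivative_pow hη hm R), sub_eq_add_neg, ← neg_smul]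
    exact (ConvergesOn.one.add ((ih.mul (ih.pow m).antideriv).smul α)).add
      ((ih.mul (ih.pow m)).antideriv.smul _)

theorem continuous_H_of_nat (hη : η ≤ 1) {m : ℕ} (hm : 1 - α = -(m * η)) (R : ℕ) :
    Continuous (H α η R) := by
  rw [continuous_iff_continuousAt]
  intro y
  have h := (convergesOn_HSeries_of_nat hη hm (|y| + 1) R).hasDerivAt (y := y) (by linarith)
  have e : H α η R = evalAt (HSeries α η R) := funext (H_eq_evalAt R)
  rw [e]
  exact h.continuousAt

theorem recursion_of_nat (hη : η ≤ 1) (hη0 : η ≠ 0) {m : ℕ} (hm : 1 - α = -(m * η)) (R : ℕ)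
    (ζ : ℝ) :
    IntervalIntegrable (fun y => H α η R y ^ ((α - 1) / η)) MeasureTheory.volume 0 ζ ∧
    IntervalIntegrable (fun y => H α η R y ^ ((α + η - 1) / η)) MeasureTheory.volume 0 ζ ∧
    H α η (R + 1) ζ = 1 + α * H α η R ζ * (∫ y in (0 : ℝ)..ζ, H α η R y ^ ((α - 1) / η)) -
      (α + η) * ∫ y in (0 : ℝ)..ζ, H α η R y ^ ((α + η - 1) / η) := by
  have e1 : (α - 1) / η = (m : ℕ) := by
    rw [div_eq_iff hη0]; linarith
  have e2 : (α + η - 1) / η = (m + 1 : ℕ) := by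
    rw [div_eq_iff hη0]; push_cast; linarith
  have hcont := continuous_H_of_nat hη hm R
  refine ⟨?_, ?_, ?_⟩
  · simp only [e1, Real.rpow_natCast]
    exact (hcont.pow m).intervalIntegrable _ _
  · simp only [e2, Real.rpow_natCast]
    exact (hcont.pow (m + 1)).intervalIntegrable _ _
  · have hc := convergesOn_HSeries_of_nat hη hm (|ζ| + 1) R
    refine H_succ hη R hc (hc.pow m) (by simp [constantCoeff_HSeries])
      (HSeries_mul_derivative_pow hη hm R) (fun y hy => ?_) (fun y hy => ?_) (by linarith)
    · rw [e1, Real.rpow_natCast, evalAt_pow hc hy, H_eq_evalAt]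
    · rw [e2, Real.rpow_natCast, evalAt_pow hc hy, H_eq_evalAt, pow_succ']

end Bounded

/-! ### Series with nonnegative coefficients -/

section Positivity

theorem exists_linear_ode (A : ℝ⟦X⟧) :
    ∃ P : ℝ⟦X⟧, constantCoeff P = 1 ∧ d⁄dX ℝ P = A * P := by
  have hs : HasSubst (antideriv A) := HasSubst.of_constantCoeff_zero' (constantCoeff_antideriv A)
  refine ⟨(PowerSeries.exp ℝ).subst (antideriv A), ?_, ?_⟩
  · have h : PowerSeries.exp ℝ = (PowerSeries.exp ℝ - 1) + 1 := by ring
    have h0 : constantCoeff ((PowerSeries.exp ℝ - 1).subst (antideriv A)) = 0 :=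
      constantCoeff_subst_eq_zero (constantCoeff_antideriv A) _ (by simp)
    rw [h, ← coe_substAlgHom hs, map_add, map_one, coe_substAlgHom hs, map_add, map_one, h0,
      zero_add]
  · rw [derivative_subst hs, derivative_antideriv, mul_comm, derivative_exp]

/-- The equation reads `(n+1) p_{n+1} = ∑ a_k p_{n-k}`, a sum of `n + 1` terms in `[0,1]`. -/
theorem coeff_ode_mem_Icc {A P : ℝ⟦X⟧} (hA : ∀ n, coeff n A ∈ Set.Icc (0 : ℝ) 1)
    (hP0 : constantCoeff P = 1) (hP : d⁄dX ℝ P = A * P) (n : ℕ) :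
    coeff n P ∈ Set.Icc (0 : ℝ) 1 := by
  induction n using Nat.strong_induction_on with
  | _ n ih =>
  cases n with
  | zero => simp [hP0]
  | succ n =>
    have h := congrArg (coeff n) hP
    rw [coeff_derivative, coeff_mul] at h
    have hterm : ∀ x ∈ Finset.HasAntidiagonal.antidiagonal n,
        coeff x.1 A * coeff x.2 P ∈ Set.Icc (0 : ℝ) 1 := by
      intro x hx
      have hx' := Finset.HasAntidiagonal.mem_antidiagonal.1 hx
      obtain ⟨h1, h2⟩ := ih x.2 (by omega)
      obtain ⟨h3, h4⟩ := hA x.1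
      exact ⟨mul_nonneg h3 h1, mul_le_one₀ h4 h1 h2⟩
    have hlow := Finset.sum_nonneg fun x hx => (hterm x hx).1
    have hup := Finset.sum_le_card_nsmul _ _ 1 fun x hx => (hterm x hx).2
    rw [← h] at hlow hup
    rw [Finset.Nat.card_antidiagonal] at hup
    have hn : (0 : ℝ) < n + 1 := by positivity
    constructor
    · exact nonneg_of_mul_nonneg_left hlow hn
    · simp only [nsmul_eq_mul, mul_one] at hup
      push_cast at hup
      nlinarith

theorem convergesOn_of_coeff_mem_Icc {P : ℝ⟦X⟧} (hP : ∀ n, coeff n P ∈ Set.Icc (0 : ℝ) 1) :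
    ConvergesOn 1 P := by
  intro ρ h0 hρ
  refine (summable_geometric_of_lt_one h0 hρ).of_nonneg_of_le (fun n => by positivity) fun n => ?_
  rw [abs_of_nonneg (hP n).1]
  exact mul_le_of_le_one_left (by positivity) (hP n).2

theorem coeff_mul_nonneg {S S' : ℝ⟦X⟧} (h : ∀ n, 0 ≤ coeff n S) (h' : ∀ n, 0 ≤ coeff n S')
    (n : ℕ) : 0 ≤ coeff n (S * S') := by
  rw [coeff_mul]
  exact Finset.sum_nonneg fun x _ => mul_nonneg (h _) (h' _)

theorem coeff_mul_le_coeff_mul {S S' T T' : ℝ⟦X⟧} (hS : ∀ n, coeff n S ≤ coeff n S')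
    (hT : ∀ n, coeff n T ≤ coeff n T') (hT0 : ∀ n, 0 ≤ coeff n T)
    (hS0 : ∀ n, 0 ≤ coeff n S') (n : ℕ) : coeff n (S * T) ≤ coeff n (S' * T') := by
  rw [coeff_mul, coeff_mul]
  exact Finset.sum_le_sum fun x _ => mul_le_mul (hS _) (hT _) (hT0 _) (hS0 _)

theorem coeff_inv_nonneg {S : ℝ⟦X⟧} (h0 : constantCoeff S = 1)
    (hS : ∀ n, coeff (n + 1) S ≤ 0) (n : ℕ) : 0 ≤ coeff n S⁻¹ := by
  induction n using Nat.strong_induction_on with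
  | _ n ih =>
  rw [PowerSeries.coeff_inv]
  split_ifs with hn
  · simp [h0]
  · rw [h0, inv_one, neg_one_mul, neg_nonneg]
    refine Finset.sum_nonpos fun x hx => ?_
    split_ifs with hx2
    · obtain ⟨k, hk⟩ : ∃ k, x.1 = k + 1 :=
        Nat.exists_eq_succ_of_ne_zero fun h => by
          have := Finset.HasAntidiagonal.mem_antidiagonal.1 hx
          omega
      rw [hk]
      exact mul_nonpos_of_nonpos_of_nonneg (hS k) (ih _ hx2)
    · exact le_rfl

theorem coeff_inv_le_coeff_inv {S S' : ℝ⟦X⟧} (h0 : constantCoeff S = 1)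
    (h0' : constantCoeff S' = 1) (hS : ∀ n, coeff (n + 1) S ≤ 0)
    (hle : ∀ n, coeff n S' ≤ coeff n S) (n : ℕ) : coeff n S⁻¹ ≤ coeff n S'⁻¹ := by
  have e : S'⁻¹ - S⁻¹ = S⁻¹ * S'⁻¹ * (S - S') := by
    have h1 : S * S⁻¹ = 1 := PowerSeries.mul_inv_cancel _ (by simp [h0])
    have h2 : S' * S'⁻¹ = 1 := PowerSeries.mul_inv_cancel _ (by simp [h0'])
    linear_combination (-S'⁻¹) * h1 + S⁻¹ * h2
  have := coeff_mul_nonneg (coeff_mul_nonneg (coeff_inv_nonneg h0 hS)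
    (coeff_inv_nonneg h0' fun n => (hle _).trans (hS n))) (S' := S - S')
    (fun n => by rw [map_sub]; exact sub_nonneg.2 (hle n)) n
  rw [← e, map_sub] at this
  linarith

end Positivity

/-! ### Unbounded degrees -/

section Unbounded

variable {α η : ℝ}

/-- The attachment weight is `η (k - 2) + (1 - α)` with `k ≥ 2`. -/
theorem weight_nonneg_of_mem_moves (hα : α ∈ Set.Icc (0 : ℝ) 1) (hη : η ∈ Set.Icc (0 : ℝ) 1)
    (T : PlantedTree) : ∀ m ∈ moves α η T, 0 ≤ m.2 := by
  induction T using planted_induction with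
  | h cs ih =>
  have hlist : ∀ l : List PlantedTree, (∀ T ∈ l, T ∈ cs) → ∀ m ∈ movesList α η l, 0 ≤ m.2 := by
    intro l
    induction l with
    | nil => simp [movesList]
    | cons T Ts ihl =>
      intro hl m hm
      rw [movesList, List.mem_append, List.mem_map, List.mem_map] at hm
      obtain ⟨a, ha, rfl⟩ | ⟨a, ha, rfl⟩ := hm
      · exact ih T (hl T (by simp)) a ha
      · exact ihl (fun T hT => hl T (by simp [hT])) a ha
  intro m hm
  rw [moves, List.mem_cons, List.mem_append, List.mem_map] at hm
  obtain rfl | hm | ⟨a, ha, rfl⟩ := hm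
  · simp only [graftWeight]
    split_ifs
    · linarith [hη.2]
    · exact hα.1
  · rw [attachMoves] at hm
    split_ifs at hm with hcs
    · simp at hm
    · rw [List.mem_map] at hm
      obtain ⟨i, -, rfl⟩ := hm
      refine div_nonneg ?_ (by positivity)
      have : (1 : ℝ) ≤ cs.length := by exact_mod_cast List.length_pos_iff_ne_nil.2 hcs
      rw [attachWeight]
      push_cast
      nlinarith [hη.1, hα.2]
  · exact hlist cs (fun _ h => h) a ha

theorem gen_le_gen (hα : α ∈ Set.Icc (0 : ℝ) 1) (hη : η ∈ Set.Icc (0 : ℝ) 1)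
    {f g : PlantedTree → ℝ} (h : ∀ T, f T ≤ g T) (T : PlantedTree) :
    gen α η f T ≤ gen α η g T :=
  List.sum_le_sum fun m hm =>
    mul_le_mul_of_nonneg_left (h _) (weight_nonneg_of_mem_moves hα hη T m hm)

theorem gen_iterate_le (hα : α ∈ Set.Icc (0 : ℝ) 1) (hη : η ∈ Set.Icc (0 : ℝ) 1)
    {f g : PlantedTree → ℝ} (h : ∀ T, f T ≤ g T) (n : ℕ) (T : PlantedTree) :
    (gen α η)^[n] f T ≤ (gen α η)^[n] g T := by
  induction n generalizing T with
  | zero => exact h T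
  | succ n ih =>
    rw [Function.iterate_succ_apply', Function.iterate_succ_apply']
    exact gen_le_gen hα hη ih T

theorem gen_iterate_nonneg (hα : α ∈ Set.Icc (0 : ℝ) 1) (hη : η ∈ Set.Icc (0 : ℝ) 1)
    {f : PlantedTree → ℝ} (h : ∀ T, 0 ≤ f T) (n : ℕ) (T : PlantedTree) :
    0 ≤ (gen α η)^[n] f T := by
  induction n generalizing T with
  | zero => exact h T
  | succ n ih =>
    rw [Function.iterate_succ_apply']
    refine List.sum_nonneg fun x hx => ?_
    rw [List.mem_map] at hx
    obtain ⟨m, hm, rfl⟩ := hx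
    exact mul_nonneg (weight_nonneg_of_mem_moves hα hη T m hm) (ih _)

theorem gen_iterate_one (n : ℕ) (T : PlantedTree) :
    (gen α η)^[n] (fun _ => (1 : ℝ)) T = (ascPochhammer ℝ n).eval (totalWeight α η T) := by
  induction n generalizing T with
  | zero => simp
  | succ n ih =>
    rw [Function.iterate_succ_apply',
      gen_congr α η (g := fun _ => (ascPochhammer ℝ n).eval (totalWeight α η T + 1) * 1)
        (fun m hm => by rw [ih, totalWeight_of_mem_moves α η T m hm, mul_one]),
      gen_const_mul, ascPochhammer_succ_left]
    simp [totalWeight, mul_comm]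

theorem gammaCoeff_succ_eq_gen (n : ℕ) :
    gammaCoeff η (n + 1) =
      -η * (gen α η)^[n] (fun _ => (1 : ℝ)) (node []) / (n + 1).factorial := by
  rw [gammaCoeff, gen_iterate_one, totalWeight_node, ascPochhammer_succ_left]
  simp [add_comm, sub_eq_add_neg]

theorem heightInd_nonneg (R : ℕ) (T : PlantedTree) : 0 ≤ heightInd R T := by
  unfold heightInd; split_ifs <;> norm_num

theorem heightInd_le_one (R : ℕ) (T : PlantedTree) : heightInd R T ≤ 1 := by
  unfold heightInd; split_ifs <;> norm_num

theorem C_succ_nonpos (hα : α ∈ Set.Icc (0 : ℝ) 1) (hη : η ∈ Set.Icc (0 : ℝ) 1) (n R : ℕ) :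
    C α η (n + 1) R ≤ 0 := by
  rw [C_succ α η hη.2]
  refine div_nonpos_of_nonpos_of_nonneg ?_ (by positivity)
  rw [neg_mul, neg_nonpos]
  exact mul_nonneg hη.1 (gen_iterate_nonneg hα hη (heightInd_nonneg R) _ _)

theorem gammaCoeff_zero : gammaCoeff η 0 = 1 := by simp [gammaCoeff]

theorem gammaCoeff_le_C (hα : α ∈ Set.Icc (0 : ℝ) 1) (hη : η ∈ Set.Icc (0 : ℝ) 1) (n R : ℕ) :
    gammaCoeff η n ≤ C α η n R := by
  cases n with
  | zero => simp [gammaCoeff_zero, C_zero]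
  | succ n =>
    rw [C_succ α η hη.2, gammaCoeff_succ_eq_gen (α := α)]
    gcongr ?_ / _
    exact mul_le_mul_of_nonpos_left (gen_iterate_le hα hη (heightInd_le_one R) _ _)
      (neg_nonpos.2 hη.1)

/-- The series `∑ₙ gammaCoeff η n Xⁿ`, that is, the formal power `(1 - X) ^ η`. -/
def gammaSeries (η : ℝ) : ℝ⟦X⟧ := PowerSeries.mk (gammaCoeff η)

theorem constantCoeff_gammaSeries : constantCoeff (gammaSeries η) = 1 := by
  rw [← coeff_zero_eq_constantCoeff_apply, gammaSeries, coeff_mk, gammaCoeff_zero]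

theorem gammaCoeff_succ (n : ℕ) :
    gammaCoeff η (n + 1) * (n + 1) = gammaCoeff η n * (n - η) := by
  rw [gammaCoeff, gammaCoeff, ascPochhammer_succ_eval, Nat.factorial_succ]
  push_cast
  field_simp
  ring

theorem one_sub_X_mul_derivative_gammaSeries :
    (1 - X) * d⁄dX ℝ (gammaSeries η) = -(η • gammaSeries η) := by
  ext n
  rw [sub_mul, one_mul, map_sub, coeff_derivative, map_neg, coeff_smul]
  cases n with
  | zero =>
    have := gammaCoeff_succ (η := η) 0
    simp only [gammaSeries, coeff_mk, coeff_zero_X_mul]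
    simp only [smul_eq_mul]
    push_cast at this ⊢
    linarith
  | succ n =>
    have := gammaCoeff_succ (η := η) (n + 1)
    rw [coeff_succ_X_mul, coeff_derivative]
    simp only [gammaSeries, coeff_mk, smul_eq_mul]
    push_cast at this ⊢
    linarith

theorem derivative_gammaSeries :
    d⁄dX ℝ (gammaSeries η) = (-η) • backward α η (fun _ => 1) (node []) := by
  ext n
  rw [coeff_derivative]
  simp only [gammaSeries, backward, coeff_mk, gammaCoeff_succ_eq_gen (α := α), coeff_smul,
    smul_eq_mul]
  rw [Nat.factorial_succ]
  push_cast
  field_simp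

/-- Without height restriction the two factors are `(1-X)^(η-1)` and `(1-X)^(-η)`. This is the upper
bound for the quotient `G_R / H_R`. -/
theorem backward_one_mul_inv (hη0 : η ≠ 0) :
    backward α η (fun _ => 1) (node []) * (gammaSeries η)⁻¹ = PowerSeries.mk 1 := by
  have h1 : (1 - X) * backward α η (fun _ => 1) (node []) = gammaSeries η := by
    have h := one_sub_X_mul_derivative_gammaSeries (η := η)
    rw [derivative_gammaSeries (α := α), mul_smul_comm, neg_smul, neg_inj] at h
    exact smul_right_injective _ hη0 h
  have h2 : gammaSeries η * (gammaSeries η)⁻¹ = 1 :=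
    PowerSeries.mul_inv_cancel _ (by simp [constantCoeff_gammaSeries])
  have h3 : (PowerSeries.mk 1 : ℝ⟦X⟧) * (1 - X) = 1 := mk_one_mul_one_sub_eq_one ℝ
  calc _ = PowerSeries.mk 1 * (((1 - X) * backward α η (fun _ => 1) (node [])) *
        (gammaSeries η)⁻¹) := by
        linear_combination (-(backward α η (fun _ => (1 : ℝ)) (node []) * (gammaSeries η)⁻¹)) * h3
    _ = _ := by rw [h1, h2, mul_one]

theorem coeff_backward_nonneg (hα : α ∈ Set.Icc (0 : ℝ) 1) (hη : η ∈ Set.Icc (0 : ℝ) 1)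
    {f : PlantedTree → ℝ} (h : ∀ T, 0 ≤ f T) (n : ℕ) (T : PlantedTree) :
    0 ≤ coeff n (backward α η f T) := by
  rw [backward, coeff_mk]
  exact div_nonneg (gen_iterate_nonneg hα hη h _ _) (by positivity)

theorem coeff_backward_mul_inv_mem_Icc (hα : α ∈ Set.Icc (0 : ℝ) 1)
    (hη : η ∈ Set.Icc (0 : ℝ) 1) (hη0 : η ≠ 0) (R n : ℕ) :
    coeff n (backward α η (heightInd R) (node []) * (HSeries α η R)⁻¹) ∈ Set.Icc (0 : ℝ) 1 := by
  have hneg : ∀ n, coeff (n + 1) (HSeries α η R) ≤ 0 := fun n => by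
    rw [HSeries, coeff_mk]; exact C_succ_nonpos hα hη n R
  have hinv := coeff_inv_nonneg (constantCoeff_HSeries α η R) hneg
  refine ⟨coeff_mul_nonneg (fun n => coeff_backward_nonneg hα hη (heightInd_nonneg R) n _) hinv n,
    ?_⟩
  have := coeff_mul_le_coeff_mul (S := backward α η (heightInd R) (node []))
    (S' := backward α η (fun _ => 1) (node [])) (fun n => ?_)
    (coeff_inv_le_coeff_inv (constantCoeff_HSeries α η R)
      (constantCoeff_gammaSeries (η := η)) hneg fun n => ?_) hinv (fun n => coeff_backward_nonneg hα hη (fun _ => zero_le_one) n _) n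
  · rw [backward_one_mul_inv hη0] at this
    simpa using this
  · rw [backward, backward, coeff_mk, coeff_mk]
    gcongr ?_ / _
    exact gen_iterate_le hα hη (heightInd_le_one R) _ _
  · rw [HSeries, gammaSeries, coeff_mk, coeff_mk]
    exact gammaCoeff_le_C hα hη n R

/-- The formal power `H_R ^ ((α - 1) / η)`. -/
theorem exists_power_series (hα : α ∈ Set.Icc (0 : ℝ) 1) (hη : η ∈ Set.Icc (0 : ℝ) 1)
    (hη0 : η ≠ 0) (R : ℕ) : ∃ P : ℝ⟦X⟧, ConvergesOn 1 P ∧ constantCoeff P = 1 ∧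
      HSeries α η R * d⁄dX ℝ P = (1 - α) • (backward α η (heightInd R) (node []) * P) := by
  obtain ⟨P, hP0, hP⟩ := exists_linear_ode
    ((1 - α) • (backward α η (heightInd R) (node []) * (HSeries α η R)⁻¹))
  refine ⟨P, convergesOn_of_coeff_mem_Icc (coeff_ode_mem_Icc (fun n => ?_) hP0 hP), hP0, ?_⟩
  · obtain ⟨h1, h2⟩ := coeff_backward_mul_inv_mem_Icc hα hη hη0 R n
    rw [coeff_smul, smul_eq_mul]
    exact ⟨mul_nonneg (by linarith [hα.2]) h1, mul_le_one₀ (by linarith [hα.1]) h1 h2⟩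
  · have h : HSeries α η R * (HSeries α η R)⁻¹ = 1 :=
      PowerSeries.mul_inv_cancel _ (by simp [constantCoeff_HSeries])
    rw [hP, smul_eq_C_mul, smul_eq_C_mul]
    linear_combination
      (PowerSeries.C (1 - α) * backward α η (heightInd R) (node []) * P) * h

/-! #### Bounds for the coefficients and for the values of `H_R` -/

/-- These are the coefficients of `(1-X)^η / (1-X) = (1-X)^(η-1)`. -/
theorem sum_gammaCoeff (n : ℕ) :
    ∑ k ∈ Finset.range (n + 1), gammaCoeff η k =
      (ascPochhammer ℝ n).eval (1 - η) / n.factorial := by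
  induction n with
  | zero => simp [gammaCoeff_zero]
  | succ n ih =>
    rw [Finset.sum_range_succ, ih, gammaCoeff, ascPochhammer_succ_eval n (1 - η),
      ascPochhammer_succ_left, Nat.factorial_succ]
    simp only [Polynomial.eval_mul, Polynomial.eval_X, Polynomial.eval_comp, Polynomial.eval_add,
      Polynomial.eval_one]
    rw [show -η + 1 = 1 - η by ring]
    push_cast
    field_simp
    ring

theorem sum_gammaCoeff_nonneg (hη : η ∈ Set.Icc (0 : ℝ) 1) (n : ℕ) :
    0 ≤ ∑ k ∈ Finset.range n, gammaCoeff η k := by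
  cases n with
  | zero => simp
  | succ n =>
    rw [sum_gammaCoeff]
    refine div_nonneg ?_ (by positivity)
    induction n with
    | zero => simp
    | succ n ih =>
      rw [ascPochhammer_succ_eval]
      exact mul_nonneg ih (by linarith [hη.2, n.cast_nonneg (α := ℝ)])

theorem abs_C_le (hα : α ∈ Set.Icc (0 : ℝ) 1) (hη : η ∈ Set.Icc (0 : ℝ) 1) (n R : ℕ) :
    |C α η n R| ≤ |gammaCoeff η n| := by
  cases n with
  | zero => simp [C_zero, gammaCoeff_zero]
  | succ n =>
    have h1 := C_succ_nonpos hα hη n R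
    have h2 := gammaCoeff_le_C hα hη (n + 1) R
    rw [abs_of_nonpos h1, abs_of_nonpos (h2.trans h1)]
    linarith

/-- All terms after the initial `1` are nonpositive and the partial sums stay nonnegative, so the
absolute values of these terms sum to at most `1`. -/
theorem summable_abs_gammaCoeff (hη : η ∈ Set.Icc (0 : ℝ) 1) :
    Summable fun n => |gammaCoeff η n| := by
  have hneg : ∀ n, gammaCoeff η (n + 1) ≤ 0 := fun n =>
    (gammaCoeff_le_C (α := 0) (by simp) hη (n + 1) 0).trans (C_succ_nonpos (by simp) hη n 0)
  rw [← summable_nat_add_iff 1]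
  refine summable_of_sum_range_le (c := 1) (fun n => abs_nonneg _) fun n => ?_
  have h := sum_gammaCoeff_nonneg hη (n + 1)
  rw [Finset.sum_range_succ', gammaCoeff_zero] at h
  simp only [abs_of_nonpos (hneg _), Finset.sum_neg_distrib]
  linarith

theorem norm_C_mul_pow_le (hα : α ∈ Set.Icc (0 : ℝ) 1) (hη : η ∈ Set.Icc (0 : ℝ) 1) (n R : ℕ)
    {y : ℝ} (hy : y ∈ Set.Icc (-1 : ℝ) 1) : ‖C α η n R * y ^ n‖ ≤ |gammaCoeff η n| := by
  rw [Real.norm_eq_abs, abs_mul, abs_pow]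
  calc |C α η n R| * |y| ^ n ≤ |C α η n R| * 1 := by
        gcongr; exact pow_le_one₀ (abs_nonneg y) (abs_le.2 hy)
    _ ≤ _ := by rw [mul_one]; exact abs_C_le hα hη n R

theorem summable_C_mul_pow (hα : α ∈ Set.Icc (0 : ℝ) 1) (hη : η ∈ Set.Icc (0 : ℝ) 1) (R : ℕ)
    {y : ℝ} (hy : y ∈ Set.Icc (-1 : ℝ) 1) : Summable fun n => C α η n R * y ^ n :=
  Summable.of_norm_bounded (summable_abs_gammaCoeff hη) fun n => norm_C_mul_pow_le hα hη n R hy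

theorem continuousOn_H (hα : α ∈ Set.Icc (0 : ℝ) 1) (hη : η ∈ Set.Icc (0 : ℝ) 1) (R : ℕ) :
    ContinuousOn (H α η R) (Set.Icc (-1) 1) :=
  continuousOn_tsum (fun _ => by fun_prop) (summable_abs_gammaCoeff hη)
    fun n _ hy => norm_C_mul_pow_le hα hη n R hy

theorem convergesOn_HSeries (hα : α ∈ Set.Icc (0 : ℝ) 1) (hη : η ∈ Set.Icc (0 : ℝ) 1) (R : ℕ) :
    ConvergesOn 1 (HSeries α η R) := by
  refine ConvergesOn.of_summable_norm fun y h0 hy => ?_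
  simp only [HSeries, coeff_mk]
  exact (summable_abs_gammaCoeff hη).of_nonneg_of_le (fun n => norm_nonneg _)
    fun n => norm_C_mul_pow_le hα hη n R ⟨by linarith, hy.le⟩

theorem convergesOn_gammaSeries (hη : η ∈ Set.Icc (0 : ℝ) 1) :
    ConvergesOn 1 (gammaSeries η) := by
  intro ρ h0 hρ
  refine (summable_abs_gammaCoeff hη).of_nonneg_of_le (fun n => by positivity) fun n => ?_
  rw [gammaSeries, coeff_mk]
  exact mul_le_of_le_one_right (abs_nonneg _) (pow_le_one₀ h0 hρ.le)

theorem evalAt_gammaSeries (hη : η ∈ Set.Icc (0 : ℝ) 1) {y : ℝ} (hy : |y| < 1) :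
    evalAt (gammaSeries η) y = (1 - y) ^ η := by
  have hX : ConvergesOn 1 (1 - X : ℝ⟦X⟧) := by
    intro ρ _ _
    refine summable_of_ne_finset_zero (s := {0, 1}) fun n hn => ?_
    simp only [Finset.mem_insert, Finset.mem_singleton, not_or] at hn
    simp [coeff_one, coeff_X, hn.1, hn.2]
  have hev : ∀ y, evalAt (1 - X : ℝ⟦X⟧) y = 1 - y := by
    intro y
    rw [evalAt, tsum_eq_sum (s := {0, 1})]
    · simp [coeff_one, coeff_X, sub_eq_add_neg]
    · intro n hn
      simp only [Finset.mem_insert, Finset.mem_singleton, not_or] at hn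
      simp [coeff_one, coeff_X, hn.1, hn.2]
  rw [evalAt_eq_rpow (S := 1 - X) (p := η) hX (convergesOn_gammaSeries hη) ?_ (by simp)
    constantCoeff_gammaSeries ?_ hy, hev]
  · intro z hz
    rw [hev]
    linarith [(abs_lt.1 hz).2]
  · rw [one_sub_X_mul_derivative_gammaSeries]
    simp

theorem rpow_le_H (hα : α ∈ Set.Icc (0 : ℝ) 1) (hη : η ∈ Set.Icc (0 : ℝ) 1) (R : ℕ) {y : ℝ}
    (h0 : 0 ≤ y) (h1 : y < 1) : (1 - y) ^ η ≤ H α η R y := by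
  have hy : |y| < 1 := by rwa [abs_of_nonneg h0]
  rw [← evalAt_gammaSeries hη hy, evalAt, H]
  refine ((convergesOn_gammaSeries hη).summable hy).tsum_le_tsum (fun n => ?_)
    (summable_C_mul_pow hα hη R ⟨by linarith, h1.le⟩)
  rw [gammaSeries, coeff_mk]
  gcongr
  exact gammaCoeff_le_C hα hη n R

theorem H_le_one (hα : α ∈ Set.Icc (0 : ℝ) 1) (hη : η ∈ Set.Icc (0 : ℝ) 1) (R : ℕ) {y : ℝ}
    (h0 : 0 ≤ y) (h1 : y ≤ 1) : H α η R y ≤ 1 := by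
  rw [H, (summable_C_mul_pow hα hη R ⟨by linarith, h1⟩).tsum_eq_zero_add, C_zero]
  have : ∑' n, C α η (n + 1) R * y ^ (n + 1) ≤ 0 :=
    tsum_nonpos fun n => mul_nonpos_of_nonpos_of_nonneg (C_succ_nonpos hα hη n R) (by positivity)
  simpa using this

theorem H_one_nonneg (hα : α ∈ Set.Icc (0 : ℝ) 1) (hη : η ∈ Set.Icc (0 : ℝ) 1) (R : ℕ) :
    0 ≤ H α η R 1 := by
  refine ge_of_tendsto' (summable_C_mul_pow hα hη R (y := 1) (by simp)).hasSum.tendsto_sum_nat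
    fun n => (sum_gammaCoeff_nonneg hη n).trans (Finset.sum_le_sum fun k _ => ?_)
  simpa using gammaCoeff_le_C hα hη k R

theorem C_one (R : ℕ) (hη : η ≤ 1) (hR : 1 ≤ R) : C α η 1 R = -η := by
  rw [C_succ α η hη 0 R]
  simp [heightInd, height, heightList, hR]

theorem H_pos (hα : α ∈ Set.Icc (0 : ℝ) 1) (hη : η ∈ Set.Ioc (0 : ℝ) 1) (R : ℕ) {y : ℝ}
    (h0 : -1 ≤ y) (h1 : y < 1) : 0 < H α η R y := by
  have hη' : η ∈ Set.Icc (0 : ℝ) 1 := ⟨hη.1.le, hη.2⟩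
  have hpos : ∀ z, 0 ≤ z → z < 1 → 0 < H α η R z := fun z hz hz1 =>
    (Real.rpow_pos_of_pos (by linarith) η).trans_le (rpow_le_H hα hη' R hz hz1)
  rcases le_or_gt 0 y with hy | hy
  · exact hpos y hy h1
  rcases Nat.eq_zero_or_pos R with rfl | hR
  · rw [H_eq_evalAt, HSeries_zero, evalAt_one]; exact one_pos
  have hs := summable_C_mul_pow hα hη' R ⟨h0, h1.le⟩
  have hs' := summable_C_mul_pow hα hη' R (y := -y) ⟨by linarith, by linarith⟩
  have hnn : 0 ≤ H α η R (-y) := by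
    rcases (show -y ≤ 1 by linarith).lt_or_eq with h | h
    · exact (hpos _ (by linarith) h).le
    · rw [h]; exact H_one_nonneg hα hη' R
  -- No term of the difference is negative, so the difference is at least its linear term, `-2 η y >
  -- 0`. This gives strict positivity even at `y = -1`, where `H_R(1)` is only known to be
  -- nonnegative.
  have hdiff : C α η 1 R * y ^ 1 - C α η 1 R * (-y) ^ 1 ≤ H α η R y - H α η R (-y) := by
    rw [H, H, ← hs.tsum_sub hs']
    refine (hs.sub hs').le_tsum 1 fun n _ => ?_
    cases n with
    | zero => simp
    | succ n =>
      have hle : y ^ (n + 1) ≤ (-y) ^ (n + 1) := by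
        calc y ^ (n + 1) ≤ |y ^ (n + 1)| := le_abs_self _
          _ = _ := by rw [abs_pow, abs_of_neg hy]
      have := mul_le_mul_of_nonpos_left hle (C_succ_nonpos hα hη' n R)
      linarith
  rw [C_one R hη.2 hR] at hdiff
  nlinarith [mul_pos hη.1 (neg_pos.2 hy)]

/-- Only the endpoint `1` can be singular; there `(1-y)^η ≤ H_R(y) ≤ 1` bounds the integrand by `1 +
(1-y)^(η q)`. -/
theorem intervalIntegrable_H_rpow (hα : α ∈ Set.Icc (0 : ℝ) 1) (hη : η ∈ Set.Ioc (0 : ℝ) 1)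
    (R : ℕ) {q ζ : ℝ} (hζ : ζ ∈ Set.Icc (-1 : ℝ) 1) (hq : -1 < η * q ∨ ζ < 1) :
    IntervalIntegrable (fun y => H α η R y ^ q) MeasureTheory.volume 0 ζ := by
  have hη' : η ∈ Set.Icc (0 : ℝ) 1 := ⟨hη.1.le, hη.2⟩
  have hcont : ContinuousOn (fun y => H α η R y ^ q) (Set.Ico (-1) 1) :=
    ((continuousOn_H hα hη' R).mono Set.Ico_subset_Icc_self).rpow_const
      fun y hy => Or.inl (H_pos hα hη R hy.1 hy.2).ne'
  rcases hζ.2.lt_or_eq with hlt | rfl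
  · refine (hcont.mono fun y hy => ?_).intervalIntegrable
    rw [Set.mem_uIcc] at hy
    obtain ⟨h1, h2⟩ | ⟨h1, h2⟩ := hy
    · exact ⟨by linarith, by linarith⟩
    · exact ⟨by linarith [hζ.1], by linarith⟩
  · have hq' : -1 < η * q := hq.resolve_right (lt_irrefl _)
    have hdom : IntervalIntegrable (fun y : ℝ => 1 + (1 - y) ^ (η * q))
        MeasureTheory.volume 0 1 := by
      refine intervalIntegrable_const.add ?_
      have := (intervalIntegral.intervalIntegrable_rpow' (a := 1) (b := 0) hq').comp_sub_left 1
      simpa using this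
    rw [intervalIntegrable_iff_integrableOn_Ioo_of_le zero_le_one] at hdom ⊢
    refine MeasureTheory.Integrable.mono' hdom
      ((hcont.mono fun y hy => ⟨by linarith [hy.1], hy.2⟩).aestronglyMeasurable
        measurableSet_Ioo) ?_
    refine (MeasureTheory.ae_restrict_iff' measurableSet_Ioo).2 (Filter.Eventually.of_forall ?_)
    rintro y ⟨hy0, hy1⟩
    have hpos := H_pos hα hη R (by linarith) hy1
    have h1y : 0 < 1 - y := by linarith
    rw [Real.norm_of_nonneg (Real.rpow_nonneg hpos.le q)]
    have hnn : 0 ≤ (1 - y) ^ (η * q) := Real.rpow_nonneg h1y.le _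
    rcases le_total 0 q with hq0 | hq0
    · have := Real.rpow_le_one hpos.le (H_le_one hα hη' R hy0.le hy1.le) hq0
      linarith
    · have := Real.rpow_le_rpow_of_nonpos (Real.rpow_pos_of_pos h1y η)
        (rpow_le_H hα hη' R hy0.le hy1) hq0
      rw [← Real.rpow_mul h1y.le] at this
      linarith

theorem H_succ_of_abs_lt_one (hα : α ∈ Set.Icc (0 : ℝ) 1) (hη : η ∈ Set.Ioc (0 : ℝ) 1) (R : ℕ)
    {z : ℝ} (hz : |z| < 1) :
    H α η (R + 1) z = 1 + α * H α η R z * (∫ y in (0 : ℝ)..z, H α η R y ^ ((α - 1) / η)) -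
      (α + η) * ∫ y in (0 : ℝ)..z, H α η R y ^ ((α + η - 1) / η) := by
  have hη' : η ∈ Set.Icc (0 : ℝ) 1 := ⟨hη.1.le, hη.2⟩
  have hη0 : η ≠ 0 := hη.1.ne'
  obtain ⟨P, hPc, hP0, hP⟩ := exists_power_series hα hη' hη0 R
  have hH := convergesOn_HSeries hα hη' R
  have hpos : ∀ y, |y| < 1 → 0 < H α η R y := fun y hy =>
    H_pos hα hη R (abs_lt.1 hy).1.le (abs_lt.1 hy).2
  have h1 : ∀ y, |y| < 1 → evalAt P y = H α η R y ^ ((α - 1) / η) := by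
    intro y hy
    rw [H_eq_evalAt]
    refine evalAt_eq_rpow hH hPc (fun z hz => ?_) (constantCoeff_HSeries α η R) hP0 ?_ hy
    · rw [← H_eq_evalAt]; exact hpos z hz
    · rw [hP, derivative_HSeries α η hη.2, smul_mul_assoc, smul_smul]
      congr 1
      field_simp
      ring
  refine H_succ hη.2 R hH hPc hP0 hP h1 (fun y hy => ?_) hz
  rw [h1 y hy, mul_comm, ← Real.rpow_add_one (hpos y hy).ne']
  congr 1
  field_simp
  ring

theorem recursion_of_pos (hα : α ∈ Set.Icc (0 : ℝ) 1) (hη : η ∈ Set.Ioc (0 : ℝ) 1) (R : ℕ)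
    {ζ : ℝ} (hζ : ζ ∈ Set.Icc (-1 : ℝ) 1) :
    ((0 < α ∨ ζ < 1) →
      IntervalIntegrable (fun y => H α η R y ^ ((α - 1) / η)) MeasureTheory.volume 0 ζ) ∧
    IntervalIntegrable (fun y => H α η R y ^ ((α + η - 1) / η)) MeasureTheory.volume 0 ζ ∧
    H α η (R + 1) ζ = 1 + α * H α η R ζ * (∫ y in (0 : ℝ)..ζ, H α η R y ^ ((α - 1) / η)) -
      (α + η) * ∫ y in (0 : ℝ)..ζ, H α η R y ^ ((α + η - 1) / η) := by
  have hη' : η ∈ Set.Icc (0 : ℝ) 1 := ⟨hη.1.le, hη.2⟩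
  have hη0 : η ≠ 0 := hη.1.ne'
  have hi1 : (0 < α ∨ ζ < 1) →
      IntervalIntegrable (fun y => H α η R y ^ ((α - 1) / η)) MeasureTheory.volume 0 ζ := by
    refine fun h => intervalIntegrable_H_rpow hα hη R hζ (h.imp_left fun h => ?_)
    rw [mul_div_cancel₀ _ hη0]
    linarith
  have hi2 : IntervalIntegrable (fun y => H α η R y ^ ((α + η - 1) / η))
      MeasureTheory.volume 0 ζ := by
    refine intervalIntegrable_H_rpow hα hη R hζ (Or.inl ?_)
    rw [mul_div_cancel₀ _ hη0]
    linarith [hα.1, hη.1]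
  refine ⟨hi1, hi2, ?_⟩
  rcases eq_or_ne ζ 0 with rfl | hζ0
  · exact H_succ_of_abs_lt_one hα hη R (by simp)
  have hsub : Set.uIcc 0 ζ ⊆ Set.Icc (-1) 1 := Set.uIcc_subset_Icc (by simp) hζ
  have hc1 : ContinuousOn
      (fun z => α * H α η R z * ∫ y in (0 : ℝ)..z, H α η R y ^ ((α - 1) / η))
      -- For `α = 0` the integral may diverge at `1`, but its factor is zero; otherwise `η q = α - 1
      -- > -1`.
      (Set.uIcc 0 ζ) := by
    rcases hα.1.eq_or_lt with h0 | h0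
    · simp only [← h0, zero_mul]
      exact continuousOn_const
    · exact (continuousOn_const.mul ((continuousOn_H hα hη' R).mono hsub)).mul
        (intervalIntegral.continuousOn_primitive_interval' (hi1 (Or.inl h0)) Set.left_mem_uIcc)
  have hc2 := intervalIntegral.continuousOn_primitive_interval' hi2 Set.left_mem_uIcc
  -- Both sides are continuous up to `ζ` and agree on the open interval, which covers `ζ = ±1`.
  refine Set.EqOn.of_subset_closure (s := Set.uIoo 0 ζ) (t := Set.uIcc 0 ζ)
    (f := H α η (R + 1)) (fun z hz => H_succ_of_abs_lt_one hα hη R ?_)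
    ((continuousOn_H hα hη' (R + 1)).mono hsub)
    ((continuousOn_const.add hc1).sub (continuousOn_const.mul hc2))
    Set.uIoo_subset_uIcc_self (closure_uIoo hζ0.symm).ge Set.right_mem_uIcc
  rw [abs_lt]
  rcases lt_or_gt_of_ne hζ0 with h | h
  · rw [Set.uIoo_of_ge h.le] at hz
    exact ⟨by linarith [hz.1, hζ.1], by linarith [hz.2]⟩
  · rw [Set.uIoo_of_le h.le] at hz
    exact ⟨by linarith [hz.1], by linarith [hz.2, hζ.2]⟩

end Unbounded

end

end AgModel

theorem mainTheorem7 (α γ : ℝ) (hα : α ∈ Set.Icc (0 : ℝ) 1) (hγ : γ ∈ Set.Icc (0 : ℝ) 1)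
    (D : ℕ∞) (hD : 3 ≤ D) (η : ℝ) (hη : η = AgModel.eta α γ D)
    (ζ : ℝ) (hζ : ζ ∈ Set.Icc (-1 : ℝ) 1) :
    (∀ R : ℕ, Summable fun n : ℕ => AgModel.C α η n R * ζ ^ n) ∧
    AgModel.H α η 0 ζ = 1 ∧
    ∀ R : ℕ, 1 ≤ R →
      ((0 < α ∨ ζ < 1) → IntervalIntegrable
        (fun y => AgModel.H α η (R - 1) y ^ ((α - 1) / η)) MeasureTheory.volume 0 ζ) ∧
      IntervalIntegrable
        (fun y => AgModel.H α η (R - 1) y ^ ((α + η - 1) / η)) MeasureTheory.volume 0 ζ ∧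
      AgModel.H α η R ζ =
        1 + α * AgModel.H α η (R - 1) ζ * (∫ y in (0 : ℝ)..ζ, AgModel.H α η (R - 1) y ^ ((α - 1) / η))
          - (α + η) * ∫ y in (0 : ℝ)..ζ, AgModel.H α η (R - 1) y ^ ((α + η - 1) / η) := by
  have hH0 : AgModel.H α η 0 ζ = 1 := by
    rw [AgModel.H_eq_evalAt, AgModel.HSeries_zero, AgModel.evalAt_one]
  have habs : |ζ| < |ζ| + 1 := lt_add_one _
  rcases eq_or_ne η 0 with h0 | h0
  -- This occurs for `γ = 1` with unbounded degrees and for `α = 1` with bounded ones; the base of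
  -- every power is `1`, so division by zero in the exponents is harmless.
  · subst h0
    have hH : ∀ R y, AgModel.H α 0 R y = 1 := fun R y => by
      rw [AgModel.H_eq_evalAt, AgModel.HSeries_eq_one, AgModel.evalAt_one]
    refine ⟨fun R => ?_, hH0, fun R _ => ?_⟩
    · have hc : AgModel.ConvergesOn (|ζ| + 1) (AgModel.HSeries α 0 R) := by
        rw [AgModel.HSeries_eq_one]; exact AgModel.ConvergesOn.one
      simpa [AgModel.HSeries] using hc.summable habs
    · simp [hH]
  by_cases hT : D = ⊤
  · have hη' : η ∈ Set.Ioc (0 : ℝ) 1 := by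
      rw [AgModel.eta, if_pos hT] at hη
      exact ⟨lt_of_le_of_ne (by linarith [hγ.2]) h0.symm, by linarith [hγ.1]⟩
    refine ⟨fun R => AgModel.summable_C_mul_pow hα ⟨hη'.1.le, hη'.2⟩ R hζ, hH0, fun R hR => ?_⟩
    obtain ⟨R, rfl⟩ := Nat.exists_eq_add_of_le' hR
    exact AgModel.recursion_of_pos hα hη' R hζ
  · rw [AgModel.eta, if_neg hT] at hη
    lift D to ℕ using hT
    have hD' : 3 ≤ D := by exact_mod_cast hD
    have hD2 : (0 : ℝ) < (D : ℝ) - 2 := by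
      have : (3 : ℝ) ≤ D := by exact_mod_cast hD'
      linarith
    rw [ENat.toNat_natCast] at hη
    have hm : 1 - α = -(((D - 2 : ℕ) : ℝ) * η) := by
      rw [hη, Nat.cast_sub (by omega)]
      push_cast
      field_simp
    have hle : η ≤ 1 := by
      have : 0 ≤ (1 - α) / ((D : ℝ) - 2) := div_nonneg (by linarith [hα.2]) hD2.le
      linarith
    refine ⟨fun R => ?_, hH0, fun R hR => ?_⟩
    · simpa [AgModel.HSeries] using
        (AgModel.convergesOn_HSeries_of_nat hle hm (|ζ| + 1) R).summable habs
    · obtain ⟨R, rfl⟩ := Nat.exists_eq_add_of_le' hR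
      obtain ⟨h1, h2, h3⟩ := AgModel.recursion_of_nat hle h0 hm R ζ
      exact ⟨fun _ => h1, h2, h3⟩
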